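/- **Theorem 1.5.** Let $M=\mathbb S^3\times\mathbb S^1$, where $\mathbb S^3\subset\mathbb R^4=\mathbb C^2$ (with $(x,y,z,u)=(x+iy,\,z+iu)$) is the unit sphere. For a smooth Riemannian metric $m$ on $M$ and $g\in\mathrm{Diff}^\infty(M)$ let $\|D(g)\|_m$ be the supremum over $x\in M$ of the operator norms, with respect to $m$, of $D_xg$ and $D_x(g^{-1})$. For a group generated by a finite set $S$ let $|g|_S$ be the word length of $g$, i.e. the least length of a product of elements of $S\cup S^{-1}$ equal to $g$. A finitely generated subgroup $\Gamma=\langle S\rangle$ of $\mathrm{Diff}^\infty(M)$ has *sub-exponential growth of derivatives* (with respect to $m$) if for every $\varepsilon>0$ there is $C_\varepsilon$ with $\|D(g)\|_m\le C_\varepsilon e^{\varepsilon|g|_S}$ for all $g\in\Gamma$; this does not depend on $S$. Otherwise it has *exponential growth of derivatives*. There are * elements $a_1,\dots,a_k\in SU(2)$ that freely generate a free subgroup; * four smooth one-parameter subgroups $(f^i_t)_{t\in\mathbb R}$, $1\le i\le 4$, of $\mathrm{Diff}^\infty(\mathbb S^1)$ with pairwise disjoint supports (the support being the closure of the set of points moved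 by the flow), such that for each $i$ there is a point $p_i$ that is, for every $t>0$, the only hyperbolic repelling fixed point of $f^i_t$, and $(f^i_1)'(p_i)=2$; * diffeomorphisms $A_1,\dots,A_k\in \mathrm{Diff}^\infty(M)$ given by $A_i(v,s)=(a_iv,F(v)s)$, where $F(x,y,z,u)=f^1_xf^2_yf^3_zf^4_u$ for $(x,y,z,u)\in\mathbb R^4$, such that the group $\Gamma=\langle A_1,\dots,A_k\rangle\subset \mathrm{Diff}^\infty(M)$ has the following properties. 1. For every smooth Riemannian metric $m$ on $M$, $\Gamma$ has exponential growth of derivatives with respect to $m$; moreover there are $\varepsilon>0$ and elements $W_n\in\Gamma$, $n\ge 0$ (depending on $m$), of word length exactly $n$ in the generators $A_1,\dots,A_k$, with $\|D(W_n)\|_m\ge e^{\varepsilon n}$ for all $n$. 2. For every $g\in\Gamma$ and every smooth Riemannian metric $m$ on $M$, $\|D(g^n)\|_m$ is bounded uniformly in $n\in\mathbb Z$; and every $g\in\Gamma$ preserves some smooth Riemannian metric $m_g$ on $M$. The metric $m_g$ must depend on $g$: no smooth Riemannian metric on $M$ is preserved by all of $\Gamma$. -/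

import Mathlib

open Set Metric Bundle
open scoped Manifold ContDiff Matrix ENNReal

noncomputable section

section General

variable {E : Type*} [NormedAddCommGroup E] [NormedSpace ℝ E]
  {H : Type*} [TopologicalSpace H] (I : ModelWithCorners ℝ E H)
  (M : Type*) [TopologicalSpace M] [ChartedSpace H M]

/-- The group `Diff^∞(M)` of smooth diffeomorphisms of `M`. -/
abbrev Diff : Type _ := Diffeomorph I I M M ∞

/-- The group law is composition: `(g * h) x = g (h x)`. -/
instance Diff.instGroup : Group (Diff I M) where
  mul g h := Diffeomorph.trans h g
  one := Diffeomorph.refl I M ∞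
  inv g := Diffeomorph.symm g
  mul_assoc _ _ _ := rfl
  one_mul _ := rfl
  mul_one _ := rfl
  inv_mul_cancel g := Diffeomorph.self_trans_symm g

theorem Diff.mul_apply (g h : Diff I M) (x : M) : (g * h) x = g (h x) := rfl

theorem Diff.one_apply (x : M) : (1 : Diff I M) x = x := rfl

/-- Smooth Riemannian metrics on `M`: smooth sections of symmetric positive definite bilinear forms
on the tangent bundle. -/
abbrev SmoothMetric [IsManifold I 1 M] : Type _ :=
  ContMDiffRiemannianMetric I ∞ E (fun x : M => TangentSpace I x)

variable {I M} [IsManifold I 1 M]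

/-- The operator norm of `D_x g : T_x M → T_{g x} M` with respect to the metric `m`. -/
def derivNormAt (m : SmoothMetric I M) (g : Diff I M) (x : M) : ℝ≥0∞ :=
  ⨆ (v : TangentSpace I x) (_ : m.inner x v v ≤ 1),
    ENNReal.ofReal (Real.sqrt (m.inner (g x) (mfderiv I I g x v) (mfderiv I I g x v)))

/-- `‖D(g)‖`: the supremum over `x` of the norms of `D_x g` and `D_x (g⁻¹)`. -/
def derivNorm (m : SmoothMetric I M) (g : Diff I M) : ℝ≥0∞ :=
  ⨆ x : M, max (derivNormAt m g x) (derivNormAt m g⁻¹ x)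

/-- The diffeomorphism `g` is an isometry of the Riemannian metric `m`. -/
def PreservesMetric (m : SmoothMetric I M) (g : Diff I M) : Prop :=
  ∀ (x : M) (v w : TangentSpace I x),
    m.inner (g x) (mfderiv I I g x v) (mfderiv I I g x w) = m.inner x v w

/-- The word length of `g` with respect to `S`: the least length of an expression of `g` as a
product of elements of `S` and their inverses (used only for `g` in the subgroup generated by
`S`). -/
def wordLength {G : Type*} [Group G] (S : Set G) (g : G) : ℕ :=
  sInf {n | ∃ l : List G, l.length = n ∧ (∀ x ∈ l, x ∈ S ∨ x⁻¹ ∈ S) ∧ l.prod = g}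

/-- Sub-exponential growth of derivatives of the finitely generated group `Γ`, measured with the
metric `m` and some finite generating set `S` (the notion does not depend on `S`). -/
def HasSubexponentialGrowth (m : SmoothMetric I M) (Γ : Subgroup (Diff I M)) : Prop :=
  ∃ S : Set (Diff I M), S.Finite ∧ Subgroup.closure S = Γ ∧
    ∀ ε : ℝ, 0 < ε → ∃ C : ℝ, ∀ g ∈ Γ,
      derivNorm m g ≤ ENNReal.ofReal (C * Real.exp (ε * wordLength S g))

/-- Exponential growth of derivatives: `Γ` is finitely generated and does not have
sub-exponential growth of derivatives. -/
def HasExponentialGrowth (m : SmoothMetric I M) (Γ : Subgroup (Diff I M)) : Prop :=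
  Γ.FG ∧ ¬ HasSubexponentialGrowth m Γ

end General

/-- The unit sphere of `ℝ⁴`. -/
abbrev S3 : Type := sphere (0 : EuclideanSpace ℝ (Fin (3 + 1))) 1

/-- The model with corners of the product manifold `S³ × S¹`. -/
abbrev modelM := (𝓡 3).prod (𝓡 1)

/-- A smooth one-parameter subgroup of `Diff^∞(S¹)`. -/
structure IsSmoothFlow (f : ℝ → Diff (𝓡 1) Circle) : Prop where
  map_add : ∀ s t : ℝ, f (s + t) = f s * f t
  smooth : ContMDiff (𝓘(ℝ, ℝ).prod (𝓡 1)) (𝓡 1) ∞ (fun p : ℝ × Circle => f p.1 p.2)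

/-- The support of a flow: the closure of the set of points that it moves. -/
def flowSupport (f : ℝ → Diff (𝓡 1) Circle) : Set Circle :=
  closure {s | ∃ t, f t s ≠ s}

/-- `p` is a fixed point of `g` at which the derivative `T_p S¹ → T_p S¹` is multiplication by `c`.
(Both `T_p S¹` and `T_{g p} S¹` are the model space, via the preferred chart at the base point; as
`g p = p` these identifications agree.) -/
def IsFixedWithMultiplier (g : Diff (𝓡 1) Circle) (p : Circle) (c : ℝ) : Prop :=
  g p = p ∧ ∀ v : EuclideanSpace ℝ (Fin 1),
    (mfderiv (𝓡 1) (𝓡 1) g p : EuclideanSpace ℝ (Fin 1) →L[ℝ] EuclideanSpace ℝ (Fin 1)) v = c • v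

/-- `p` is a hyperbolic repelling fixed point of `g`. -/
def IsHyperbolicRepelling (g : Diff (𝓡 1) Circle) (p : Circle) : Prop :=
  ∃ c : ℝ, 1 < |c| ∧ IsFixedWithMultiplier g p c

/-- Four smooth flows on the circle with pairwise disjoint supports such that the `i`-th one has,
at each positive time, exactly one hyperbolic repelling fixed point `pᵢ` (the same for all positive
times), and its time-one map has derivative `2` at `pᵢ`. -/
structure IsFlowQuadruple (f : Fin 4 → ℝ → Diff (𝓡 1) Circle) : Prop where
  flow : ∀ i, IsSmoothFlow (f i)
  disjoint : ∀ i j, i ≠ j → Disjoint (flowSupport (f i)) (flowSupport (f j))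
  repelling : ∀ i, ∃ p : Circle, IsFixedWithMultiplier (f i 1) p 2 ∧
    ∀ t : ℝ, 0 < t → ∀ q : Circle, IsHyperbolicRepelling (f i t) q ↔ q = p

/-- The map `F : ℝ⁴ → Diff(S¹)`, `F(x,y,z,u) = f¹_x f²_y f³_z f⁴_u`. -/
def flowProduct (f : Fin 4 → ℝ → Diff (𝓡 1) Circle) (v : EuclideanSpace ℝ (Fin (3 + 1))) :
    Diff (𝓡 1) Circle :=
  f 0 (v 0) * f 1 (v 1) * f 2 (v 2) * f 3 (v 3)

/-- The identification `ℝ⁴ = ℂ²`, `(x,y,z,u) ↦ (x + iy, z + iu)`. -/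
def toC2 (v : EuclideanSpace ℝ (Fin (3 + 1))) : Fin 2 → ℂ := ![⟨v 0, v 1⟩, ⟨v 2, v 3⟩]

/-- `A` is the skew product `A(v, s) = (a v, F(v) s)` on `S³ × S¹`. -/
def IsSkewProduct (f : Fin 4 → ℝ → Diff (𝓡 1) Circle)
    (a : Matrix.specialUnitaryGroup (Fin 2) ℂ) (A : Diff modelM (S3 × Circle)) : Prop :=
  ∀ (v : S3) (s : Circle),
    toC2 (A (v, s)).1 = (a : Matrix (Fin 2) (Fin 2) ℂ) *ᵥ toC2 v ∧
      (A (v, s)).2 = flowProduct f v s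

end

/-! The supports of the four flows are disjoint, so the flows commute and `F` is a homomorphism from
ℝ⁴ to Diff(S¹) (`flowProduct_add`). Hence the maps (v, s) ↦ (R v, F(Q v) s), with R a linear
isometry and Q any linear endomorphism of ℝ⁴, form a group with law (R', Q')(R, Q) = (R'R, Q + Q'R)
(`skewDiffeo_mul`). The generators are the pairs (aᵢ, 1), so each element of Γ is a pair (a, Q) in
which a is a word in the aᵢ and Q is linear.

Isometries. For a nontrivial word, a ≠ 1 by freeness. An element of SU(2) other than 1 fixes no
nonzero vector, so a - 1 is invertible and Q = C a - C with C linear (`exists_comp_suRep_sub`).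
Conjugation by (1, -C) turns (a, Q) into (a, 0), an isometry of the product metric, so (a, Q)
preserves the pullback of that metric (`exists_preservesMetric_skewDiffeo`). Any two metrics on a
compact manifold are comparable, so the powers of (a, Q) have bounded derivatives in every metric.

Growth. Over v, at the repelling point of the first flow, (R, Q) has fibre derivative 2 to the power
(Q v)₀. For a positive word, (Q v)₀ is the sum of the first coordinates along the orbit of v. The
five aᵢ are chosen so that each unit vector is sent by one of them to a point with first coordinate
at least 1/26; a greedy choice of letters gives positive words of length n with derivative at least
a constant times 2^(n/26) (`exists_expanding_word`, `exists_exp_le_of_derivNorm_le`).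
Submultiplicativity removes the constant at the price of half the exponent. Positive words in a free
group are geodesic, so the word length is exactly n.

Freeness is ping-pong modulo a prime above 13: the matrices 13 aᵢ have Gaussian integer entries and
determinant 169, so modulo the prime they and their adjugates have rank one
(`injective_lift_suGen`). -/

noncomputable section

/-! ### A free family in `SU(2)` -/

/-- Five Gaussian integer matrices of determinant `169`. -/
def gaussGen : Fin 5 → Matrix (Fin 2) (Fin 2) GaussianInt :=
  ![!![⟨12, 4⟩, ⟨3, 0⟩; ⟨-3, 0⟩, ⟨12, -4⟩],
    !![⟨12, -4⟩, ⟨3, 0⟩; ⟨-3, 0⟩, ⟨12, 4⟩],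
    !![⟨-12, 0⟩, ⟨5, 0⟩; ⟨-5, 0⟩, ⟨-12, 0⟩],
    !![⟨3, 0⟩, ⟨-4, -12⟩; ⟨4, -12⟩, ⟨3, 0⟩],
    !![⟨-3, 0⟩, ⟨-4, 12⟩; ⟨4, 12⟩, ⟨-3, 0⟩]]

/-- The matrix of a letter: a generator or its adjugate. -/
def gaussLetter (l : Fin 5 × Bool) : Matrix (Fin 2) (Fin 2) GaussianInt :=
  cond l.2 (gaussGen l.1) (gaussGen l.1).adjugate

/-- Reduction of Gaussian integers modulo the prime `3 + 2i` above `13`. -/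
def gaussMod : GaussianInt →+* ZMod 13 := Zsqrtd.lift ⟨5, by decide⟩

/-- The image line of a letter modulo `13`. -/
def letterImage (l : Fin 5 × Bool) : Fin 2 → ZMod 13 :=
  if (gaussLetter l).map gaussMod *ᵥ ![1, 0] = 0 then (gaussLetter l).map gaussMod *ᵥ ![0, 1]
  else (gaussLetter l).map gaussMod *ᵥ ![1, 0]

/-- The ping-pong table: modulo the prime each letter has rank one, and it kills the image line of
another letter only if the two are mutually inverse. -/
theorem letter_mulVec_letterImage : ∀ l l' : Fin 5 × Bool, (l.1 = l'.1 → l.2 = l'.2) →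
    ∃ c : ZMod 13, c ≠ 0 ∧ (gaussLetter l).map gaussMod *ᵥ letterImage l' = c • letterImage l := by
  decide +kernel

theorem letterImage_ne_zero : ∀ l : Fin 5 × Bool, letterImage l ≠ 0 := by
  decide +kernel

/-- By the ping-pong table, each letter carries the image line of the letter to its right onto its
own. In particular a nonempty reduced word does not vanish modulo the prime. -/
theorem reduced_word_mulVec {l : Fin 5 × Bool} {L : List (Fin 5 × Bool)}
    (h : FreeGroup.IsReduced (l :: L)) : ∃ w : Fin 2 → ZMod 13, ∃ c : ZMod 13, c ≠ 0 ∧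
      (((l :: L).map gaussLetter).prod).map gaussMod *ᵥ w = c • letterImage l := by
  have : Fact (Nat.Prime 13) := ⟨by norm_num⟩
  induction L generalizing l with
  | nil =>
    obtain ⟨c, hc, h'⟩ := letter_mulVec_letterImage l l fun _ => rfl
    exact ⟨letterImage l, c, hc, by simpa using h'⟩
  | cons l' L ih =>
    rw [FreeGroup.isReduced_cons_cons] at h
    obtain ⟨w, c, hc, hw⟩ := ih h.2
    obtain ⟨d, hd, h'⟩ := letter_mulVec_letterImage l l' h.1
    refine ⟨w, c * d, mul_ne_zero hc hd, ?_⟩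
    rw [List.map_cons, List.prod_cons, Matrix.map_mul, ← Matrix.mulVec_mulVec, hw,
      Matrix.mulVec_smul, h', smul_smul]

theorem toComplex_ofNat (n : ℕ) [n.AtLeastTwo] :
    GaussianInt.toComplex (ofNat(n)) = ofNat(n) := map_ofNat _ n

theorem star_gaussGen (i : Fin 5) :
    star ((gaussGen i).map GaussianInt.toComplex) =
      (gaussGen i).adjugate.map GaussianInt.toComplex := by
  rw [Matrix.adjugate_fin_two]
  ext j k
  fin_cases i <;> fin_cases j <;> fin_cases k <;>
    apply Complex.ext <;> simp [gaussGen, GaussianInt.toComplex_def]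

theorem det_gaussGen (i : Fin 5) : (gaussGen i).det = 169 := by
  rw [Matrix.det_fin_two]
  fin_cases i <;> simp [gaussGen, Zsqrtd.ext_iff]

theorem gaussGen_mul_star (i : Fin 5) :
    (gaussGen i).map GaussianInt.toComplex * star ((gaussGen i).map GaussianInt.toComplex) =
      (169 : ℂ) • 1 := by
  rw [star_gaussGen, ← Matrix.map_mul, Matrix.mul_adjugate, det_gaussGen]
  ext j k
  by_cases h : j = k <;> simp [h, toComplex_ofNat]

/-- Five elements of `SU(2)`. -/
def suGen (i : Fin 5) : Matrix.specialUnitaryGroup (Fin 2) ℂ :=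
  ⟨(1 / 13 : ℂ) • (gaussGen i).map GaussianInt.toComplex, by
    rw [Matrix.mem_specialUnitaryGroup_iff, Matrix.mem_unitaryGroup_iff]
    constructor
    · rw [star_smul, smul_mul_smul_comm, gaussGen_mul_star, smul_smul]
      norm_num
    · have h : ((gaussGen i).map GaussianInt.toComplex).det = 169 := by
        have := congrArg GaussianInt.toComplex (det_gaussGen i)
        rw [RingHom.map_det] at this
        simpa [toComplex_ofNat] using this
      rw [Matrix.det_smul, h]
      norm_num⟩

theorem coe_suLetter (l : Fin 5 × Bool) :
    ((cond l.2 (suGen l.1) (suGen l.1)⁻¹ : Matrix.specialUnitaryGroup (Fin 2) ℂ) :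
      Matrix (Fin 2) (Fin 2) ℂ) = (1 / 13 : ℂ) • (gaussLetter l).map GaussianInt.toComplex := by
  obtain ⟨i, b⟩ := l
  cases b
  · change star ((1 / 13 : ℂ) • (gaussGen i).map GaussianInt.toComplex) = _
    rw [star_smul, star_gaussGen]
    simp [gaussLetter]
  · rfl

theorem coe_suWord (L : List (Fin 5 × Bool)) :
    (((L.map fun l => cond l.2 (suGen l.1) (suGen l.1)⁻¹).prod :
      Matrix.specialUnitaryGroup (Fin 2) ℂ) : Matrix (Fin 2) (Fin 2) ℂ) =
      (1 / 13 : ℂ) ^ L.length • ((L.map gaussLetter).prod).map GaussianInt.toComplex := by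
  induction L with
  | nil => simp
  | cons l L ih =>
    rw [List.map_cons, List.prod_cons, Submonoid.coe_mul, ih, coe_suLetter, List.map_cons,
      List.prod_cons, Matrix.map_mul, smul_mul_smul_comm, List.length_cons, pow_succ']

/-- If a reduced word of length n > 0 were trivial in SU(2), its integral product would be 13ⁿ times
the identity. This vanishes modulo 3 + 2i, against `reduced_word_mulVec`. -/
theorem injective_lift_suGen : Function.Injective (FreeGroup.lift suGen) := by
  rw [injective_iff_map_eq_one]
  intro w hw
  by_contra hne
  have hL : w.toWord ≠ [] := fun h => hne (FreeGroup.toWord_eq_nil_iff.1 h)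
  have hred : FreeGroup.IsReduced w.toWord := FreeGroup.isReduced_toWord
  have h1 : (w.toWord.map fun l => cond l.2 (suGen l.1) (suGen l.1)⁻¹).prod = 1 := by
    rw [← FreeGroup.lift_mk, FreeGroup.mk_toWord, hw]
  have h2 := coe_suWord w.toWord
  rw [h1] at h2
  have h3 : (w.toWord.map gaussLetter).prod = (13 : GaussianInt) ^ w.toWord.length • 1 := by
    apply Matrix.map_injective (f := GaussianInt.toComplex) GaussianInt.toComplex_injective
    have h4 := congrArg (fun X => (13 : ℂ) ^ w.toWord.length • X) h2
    simp only [smul_smul, ← mul_pow] at h4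
    norm_num at h4
    refine h4.symm.trans ?_
    ext j k
    by_cases h : j = k <;> simp [h, toComplex_ofNat]
  cases h5 : w.toWord with
  | nil => exact hL h5
  | cons l L =>
    rw [h5] at h3 hred
    obtain ⟨v, c, hc, hv⟩ := reduced_word_mulVec hred
    rw [h3] at hv
    have h6 : ((13 : GaussianInt) ^ (l :: L).length • (1 : Matrix (Fin 2) (Fin 2) GaussianInt)).map
        gaussMod = 0 := by
      ext j k
      have : gaussMod 13 = 0 := by decide
      simp [pow_succ, this]
    rw [h6, Matrix.zero_mulVec] at hv
    have : Fact (Nat.Prime 13) := ⟨by norm_num⟩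
    exact (smul_ne_zero hc (letterImage_ne_zero l)) hv.symm

/-- An element of `SU(2)` that fixes a nonzero vector is trivial. -/
theorem eq_one_of_mulVec_eq {a : Matrix.specialUnitaryGroup (Fin 2) ℂ} {v : Fin 2 → ℂ}
    (hv : v ≠ 0) (h : (a : Matrix (Fin 2) (Fin 2) ℂ) *ᵥ v = v) : a = 1 := by
  obtain ⟨A, hA⟩ := a
  obtain ⟨hU, hdet⟩ := Matrix.mem_specialUnitaryGroup_iff.1 hA
  have hstar : star A = A.adjugate := by
    have h1 : star A * A = 1 := (Matrix.mem_unitaryGroup_iff'.1 hU)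
    calc star A = star A * (A * A.adjugate) := by rw [Matrix.mul_adjugate, hdet]; simp
      _ = A.adjugate := by rw [← mul_assoc, h1, one_mul]
  have h0 : (A - 1).det = 0 := by
    refine Matrix.exists_mulVec_eq_zero_iff.1 ⟨v, hv, ?_⟩
    rw [Matrix.sub_mulVec, h, Matrix.one_mulVec, sub_self]
  rw [Matrix.adjugate_fin_two] at hstar
  have e00 := congrFun (congrFun hstar 0) 0
  have e10 := congrFun (congrFun hstar 1) 0
  simp [Matrix.star_apply] at e00 e10
  rw [Matrix.det_fin_two] at h0
  simp only [Matrix.sub_apply, Matrix.one_apply_eq, ne_eq, zero_ne_one, not_false_eq_true,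
    Matrix.one_apply_ne, sub_zero, one_ne_zero] at h0
  have e01 : A 1 0 = - (starRingEnd ℂ) (A 0 1) := by rw [e10]; ring
  rw [← e00, e01] at h0
  -- The matrix has rows (α, β) and (-β̄, ᾱ), so det (A - 1) = |α - 1|² + |β|².
  have h7 : Complex.normSq (A 0 0 - 1) + Complex.normSq (A 0 1) = 0 := by
    have : ((Complex.normSq (A 0 0 - 1) + Complex.normSq (A 0 1) : ℝ) : ℂ) = 0 := by
      push_cast
      rw [← Complex.mul_conj, ← Complex.mul_conj, ← h0]
      simp
    exact_mod_cast this
  have h8 := Complex.normSq_nonneg (A 0 0 - 1)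
  have h9 := Complex.normSq_nonneg (A 0 1)
  have h00 : A 0 0 = 1 := sub_eq_zero.1 (Complex.normSq_eq_zero.1 (by linarith))
  have h01 : A 0 1 = 0 := Complex.normSq_eq_zero.1 (by linarith)
  apply Subtype.ext
  ext j k
  fin_cases j <;> fin_cases k
  · simpa using h00
  · simpa using h01
  · simpa [h01] using e01
  · simpa [h00] using e00.symm

/-! ### A smooth flow on the line supported in `[-1, 1]` -/

section LineFlow

open Real Filter Topology

/-- A diffeomorphism from `(-1, 1)` to the line. -/
def stretch (x : ℝ) : ℝ := x / (1 - x ^ 2)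

/-- The inverse of `stretch`. -/
def shrink (r : ℝ) : ℝ := 2 * r / (1 + √(1 + 4 * r ^ 2))

theorem abs_shrink_lt_one (r : ℝ) : |shrink r| < 1 := by
  have h : 0 < 1 + √(1 + 4 * r ^ 2) := by positivity
  have h2 : |2 * r| < 1 + √(1 + 4 * r ^ 2) := by
    have : |2 * r| ≤ √(1 + 4 * r ^ 2) := by
      apply Real.le_sqrt_of_sq_le
      rw [sq_abs]
      nlinarith
    linarith
  rw [shrink, abs_div, abs_of_pos h, div_lt_one h]
  exact h2

theorem one_sub_sq_pos {x : ℝ} (hx : |x| < 1) : 0 < 1 - x ^ 2 := by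
  have := (sq_lt_one_iff_abs_lt_one x).2 hx
  linarith

theorem stretch_shrink (r : ℝ) : stretch (shrink r) = r := by
  have h := one_sub_sq_pos (abs_shrink_lt_one r)
  rw [stretch, div_eq_iff h.ne']
  have hs : √(1 + 4 * r ^ 2) ^ 2 = 1 + 4 * r ^ 2 := Real.sq_sqrt (by positivity)
  have hp : 0 < 1 + √(1 + 4 * r ^ 2) := by positivity
  rw [shrink]
  generalize √(1 + 4 * r ^ 2) = q at hs hp
  field_simp
  linear_combination (-r) * hs

theorem shrink_stretch {x : ℝ} (hx : |x| < 1) : shrink (stretch x) = x := by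
  have h := one_sub_sq_pos hx
  have hs : √(1 + 4 * stretch x ^ 2) = (1 + x ^ 2) / (1 - x ^ 2) := by
    rw [Real.sqrt_eq_iff_eq_sq (by positivity) (by positivity)]
    rw [stretch]
    field_simp
    ring
  rw [shrink, hs, stretch]
  field_simp
  ring

theorem stretch_neg (x : ℝ) : stretch (-x) = -stretch x := by
  simp [stretch, neg_div]

theorem shrink_neg (x : ℝ) : shrink (-x) = -shrink x := by
  simp [shrink, neg_div]

theorem contDiff_shrink : ContDiff ℝ ∞ shrink := by
  unfold shrink
  refine ContDiff.div (by fun_prop) (contDiff_const.add (ContDiff.sqrt (by fun_prop) ?_)) ?_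
  · intro x
    positivity
  · intro x
    positivity

/-- A flow on the line, conjugate to the flow of dilations. -/
def dilationFlow (t r : ℝ) : ℝ := arsinh (arsinh (exp (t * log 2) * sinh (sinh r)))

theorem dilationFlow_add (s t r : ℝ) :
    dilationFlow (s + t) r = dilationFlow s (dilationFlow t r) := by
  simp only [dilationFlow, sinh_arsinh, add_mul, exp_add, mul_assoc]

theorem dilationFlow_zero (r : ℝ) : dilationFlow 0 r = r := by
  simp [dilationFlow]

theorem dilationFlow_neg (t r : ℝ) : dilationFlow t (-r) = -dilationFlow t r := by
  simp [dilationFlow]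

theorem dilationFlow_pos {r : ℝ} (t : ℝ) (hr : 0 < r) : 0 < dilationFlow t r := by
  simp only [dilationFlow, arsinh_pos_iff]
  have : 0 < sinh (sinh r) := sinh_pos_iff.2 (sinh_pos_iff.2 hr)
  positivity

theorem contDiff_dilationFlow : ContDiff ℝ ∞ fun p : ℝ × ℝ => dilationFlow p.1 p.2 := by
  unfold dilationFlow
  exact ContDiff.arsinh (ContDiff.arsinh (by fun_prop))

/-- A smooth flow on the line with support `[-1, 1]`. -/
def bumpFlow (t x : ℝ) : ℝ := if |x| < 1 then shrink (dilationFlow t (stretch x)) else x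

theorem bumpFlow_of_lt {x : ℝ} (t : ℝ) (hx : |x| < 1) :
    bumpFlow t x = shrink (dilationFlow t (stretch x)) := if_pos hx

theorem bumpFlow_of_le {x : ℝ} (t : ℝ) (hx : 1 ≤ |x|) : bumpFlow t x = x := if_neg hx.not_gt

theorem abs_bumpFlow_lt {x : ℝ} (t : ℝ) (hx : |x| < 1) : |bumpFlow t x| < 1 := by
  rw [bumpFlow_of_lt t hx]
  exact abs_shrink_lt_one _

theorem bumpFlow_add (s t x : ℝ) : bumpFlow (s + t) x = bumpFlow s (bumpFlow t x) := by
  rcases lt_or_ge |x| 1 with hx | hx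
  · rw [bumpFlow_of_lt s (abs_bumpFlow_lt t hx), bumpFlow_of_lt _ hx, bumpFlow_of_lt _ hx,
      stretch_shrink, dilationFlow_add]
  · simp only [bumpFlow_of_le _ hx]

theorem bumpFlow_zero (x : ℝ) : bumpFlow 0 x = x := by
  rcases lt_or_ge |x| 1 with hx | hx
  · rw [bumpFlow_of_lt _ hx, dilationFlow_zero, shrink_stretch hx]
  · rw [bumpFlow_of_le _ hx]

theorem bumpFlow_neg (t x : ℝ) : bumpFlow t (-x) = -bumpFlow t x := by
  simp only [bumpFlow, abs_neg, stretch_neg, dilationFlow_neg, shrink_neg]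
  split_ifs <;> rfl

theorem eq_zero_of_bumpFlow_eq {t x : ℝ} (ht : t ≠ 0) (hx : |x| < 1) (h : bumpFlow t x = x) :
    x = 0 := by
  rw [bumpFlow_of_lt t hx] at h
  have h1 : dilationFlow t (stretch x) = stretch x := by
    conv_rhs => rw [← h, stretch_shrink]
  have h2 : exp (t * log 2) * sinh (sinh (stretch x)) = sinh (sinh (stretch x)) := by
    conv_rhs => rw [← h1, dilationFlow, sinh_arsinh, sinh_arsinh]
  have h3 : exp (t * log 2) ≠ 1 := by
    have : log 2 ≠ 0 := (log_pos one_lt_two).ne'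
    simp [ht, this]
  have h4 : sinh (sinh (stretch x)) = 0 := by
    by_contra hne
    exact h3 (mul_right_cancel₀ hne (by rw [h2, one_mul]))
  rw [sinh_eq_zero, sinh_eq_zero, stretch, div_eq_zero_iff] at h4
  exact h4.resolve_right (one_sub_sq_pos hx).ne'

/-! ### Smoothness at the ends of the support -/

/-- The distance from `bumpFlow t x` to the end of the support in logarithmic coordinates, as a
smooth function of `t` and of the parameter `ρ = 1 / stretch x`. -/
def endShift (t ρ : ℝ) : ℝ :=
  let E := expNegInvGlue ρ
  let G := expNegInvGlue E * exp E
  let c := exp (t * log 2) * (1 - G) / 2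
  let B := (1 - E ^ 2) / 2 + E * log (c + √(G + c ^ 2))
  log (B + √(E ^ 2 + B ^ 2))

theorem endShift_of_nonpos {ρ : ℝ} (t : ℝ) (h : ρ ≤ 0) : endShift t ρ = 0 := by
  have h1 : √((2⁻¹ : ℝ) ^ 2) = 2⁻¹ := Real.sqrt_sq (by norm_num)
  simp only [endShift, expNegInvGlue.zero_of_nonpos h, expNegInvGlue.zero]
  norm_num

/-- At ρ = 0 both E and G vanish, c = 2ᵗ/2 and B = 1/2, so every root and logarithm is taken at a
positive number. The double `sinh` in `dilationFlow` is what makes the shift flat: with one `sinh`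
the shift would tend to t log 2, and the flow would not be smooth at the end of its support. -/
theorem contDiffAt_endShift (t : ℝ) :
    ContDiffAt ℝ ∞ (fun p : ℝ × ℝ => endShift p.1 p.2) (t, 0) := by
  have hE : ContDiff ℝ ∞ fun p : ℝ × ℝ => expNegInvGlue p.2 :=
    (expNegInvGlue.contDiff (n := ⊤)).comp contDiff_snd
  have hG : ContDiff ℝ ∞ fun p : ℝ × ℝ =>
      expNegInvGlue (expNegInvGlue p.2) * exp (expNegInvGlue p.2) :=
    ((expNegInvGlue.contDiff (n := ⊤)).comp hE).mul hE.exp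
  have hc : ContDiff ℝ ∞ fun p : ℝ × ℝ => exp (p.1 * log 2) *
      (1 - expNegInvGlue (expNegInvGlue p.2) * exp (expNegInvGlue p.2)) / 2 := by fun_prop
  have hpos : 0 < exp (t * log 2) / 2 := by positivity
  have hB : ContDiffAt ℝ ∞ (fun p : ℝ × ℝ => (1 - expNegInvGlue p.2 ^ 2) / 2 + expNegInvGlue p.2 *
      log (exp (p.1 * log 2) *
      (1 - expNegInvGlue (expNegInvGlue p.2) * exp (expNegInvGlue p.2)) / 2 +
      √(expNegInvGlue (expNegInvGlue p.2) * exp (expNegInvGlue p.2) + (exp (p.1 * log 2) *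
      (1 - expNegInvGlue (expNegInvGlue p.2) * exp (expNegInvGlue p.2)) / 2) ^ 2))) (t, 0) := by
    refine ContDiffAt.add (by fun_prop) (hE.contDiffAt.mul (ContDiffAt.log ?_ ?_))
    · refine hc.contDiffAt.add (ContDiffAt.sqrt (hG.add (hc.pow 2)).contDiffAt ?_)
      simp [expNegInvGlue.zero]
    · simp only [expNegInvGlue.zero]
      simp only [zero_mul, sub_zero, mul_one, zero_add]
      positivity
  refine ContDiffAt.log (hB.add (ContDiffAt.sqrt ((hE.contDiffAt.pow 2).add (hB.pow 2)) ?_)) ?_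
  · simp [expNegInvGlue.zero]
  · simp only [expNegInvGlue.zero]
    simp only [zero_mul, ne_eq, OfNat.ofNat_ne_zero, not_false_eq_true, zero_pow, sub_zero,
      zero_add, add_zero]
    positivity

/-- With r = 1/ρ, `endShift` is the displacement of r under the flow. Here E = e^(-r) and G = e^(-2
sinh r), the growing exponentials having been factored out of both `arsinh`. -/
theorem dilationFlow_eq_add_endShift {ρ : ℝ} (t : ℝ) (h : 0 < ρ) :
    dilationFlow t ρ⁻¹ = ρ⁻¹ + endShift t ρ := by
  have hE : expNegInvGlue ρ = exp (-ρ⁻¹) := by simp [expNegInvGlue, h.not_ge]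
  have hEpos : 0 < exp (-ρ⁻¹) := exp_pos _
  have hG : expNegInvGlue (exp (-ρ⁻¹)) * exp (exp (-ρ⁻¹)) = exp (-(2 * sinh ρ⁻¹)) := by
    rw [expNegInvGlue, if_neg hEpos.not_ge, ← exp_add, sinh_eq, ← exp_neg, neg_neg]
    ring_nf
  -- Used twice, once for each `arsinh`: with b = sinh r for the inner one and b = r for the outer
  -- one.
  have key : ∀ a b q : ℝ, 0 < a + √(q + a ^ 2) → q = exp (-(2 * b)) →
      arsinh (exp b * a) = b + log (a + √(q + a ^ 2)) := by
    intro a b q hpos hq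
    rw [arsinh]
    have h1 : 1 + (exp b * a) ^ 2 = exp b ^ 2 * (q + a ^ 2) := by
      have : exp b ^ 2 * q = 1 := by
        rw [hq, ← exp_nat_mul, ← exp_add]
        simp
      rw [mul_add, this]
      ring
    rw [h1, Real.sqrt_mul (by positivity), Real.sqrt_sq (exp_pos b).le, ← mul_add,
      log_mul (exp_pos b).ne' hpos.ne', log_exp]
  have pos : ∀ a q : ℝ, 0 < q → 0 < a + √(q + a ^ 2) := by
    intro a q hq
    have : |a| < √(q + a ^ 2) := by
      rw [← Real.sqrt_sq_eq_abs]
      exact Real.sqrt_lt_sqrt (sq_nonneg a) (by linarith)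
    have := neg_abs_le a
    linarith
  simp only [endShift, hE, hG]
  set s := sinh ρ⁻¹ with hs
  set c := exp (t * log 2) * (1 - exp (-(2 * s))) / 2 with hc
  set L := log (c + √(exp (-(2 * s)) + c ^ 2)) with hL
  have h1 : arsinh (exp (t * log 2) * sinh s) = s + L := by
    rw [hL, ← key c s _ (pos _ _ (exp_pos _)) rfl]
    congr 1
    have : exp (-s) = exp s * exp (-(2 * s)) := by
      rw [← exp_add]
      ring_nf
    rw [sinh_eq, hc, this]
    ring
  rw [dilationFlow, h1]
  have h2 : s + L = exp ρ⁻¹ * ((1 - exp (-ρ⁻¹) ^ 2) / 2 + exp (-ρ⁻¹) * L) := by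
    have : exp ρ⁻¹ * exp (-ρ⁻¹) = 1 := by rw [← exp_add]; simp
    rw [hs, sinh_eq]
    linear_combination (exp (-ρ⁻¹) / 2 - L) * this
  rw [h2]
  refine key _ _ _ (pos _ _ (by positivity)) ?_
  rw [← exp_nat_mul]
  ring_nf

/-- The inverse of `x ↦ (1 - x ^ 2) / x` on the positive half-line. -/
def endChart (ρ : ℝ) : ℝ := (-ρ + √(ρ ^ 2 + 4)) / 2

theorem endChart_inv {r : ℝ} (hr : 0 < r) : endChart r⁻¹ = shrink r := by
  have h1 : √(r⁻¹ ^ 2 + 4) = r⁻¹ * √(1 + 4 * r ^ 2) := by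
    rw [Real.sqrt_eq_iff_eq_sq (by positivity) (by positivity), mul_pow, Real.sq_sqrt (by positivity)]
    field_simp
  have hs : √(1 + 4 * r ^ 2) ^ 2 = 1 + 4 * r ^ 2 := Real.sq_sqrt (by positivity)
  have hp : 0 < 1 + √(1 + 4 * r ^ 2) := by positivity
  rw [endChart, h1, shrink]
  generalize √(1 + 4 * r ^ 2) = q at hs hp
  field_simp
  linear_combination hs

theorem endChart_eq {x : ℝ} (hx : 0 < x) : endChart ((1 - x ^ 2) / x) = x := by
  have h1 : √(((1 - x ^ 2) / x) ^ 2 + 4) = (1 + x ^ 2) / x := by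
    rw [Real.sqrt_eq_iff_eq_sq (by positivity) (by positivity)]
    field_simp
    ring
  rw [endChart, h1]
  field_simp
  ring

/-- The coordinate ρ = 1 / `stretch x` extends smoothly across x = 1. Beyond that point ρ ≤ 0 and
the shift is zero, so one formula describes the flow on both sides. -/
theorem bumpFlow_eq_endChart {x : ℝ} (t : ℝ) (hx : 0 < x) :
    bumpFlow t x =
      endChart ((1 - x ^ 2) / x / (1 + (1 - x ^ 2) / x * endShift t ((1 - x ^ 2) / x))) := by
  rcases lt_or_ge x 1 with h | h
  · have hx1 : |x| < 1 := by rwa [abs_of_pos hx]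
    have hd := one_sub_sq_pos hx1
    have hρ : 0 < (1 - x ^ 2) / x := by positivity
    have hs : stretch x = ((1 - x ^ 2) / x)⁻¹ := by rw [stretch, inv_div]
    rw [bumpFlow_of_lt t hx1, ← endChart_inv (dilationFlow_pos t (by rw [hs]; positivity)), hs,
      dilationFlow_eq_add_endShift t hρ]
    congr 1
    generalize (1 - x ^ 2) / x = ρ at hρ
    rw [show 1 + ρ * endShift t ρ = ρ * (ρ⁻¹ + endShift t ρ) by field_simp,
      div_mul_cancel_left₀ hρ.ne']
  · have hρ : (1 - x ^ 2) / x ≤ 0 := div_nonpos_of_nonpos_of_nonneg (by nlinarith) hx.le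
    rw [endShift_of_nonpos t hρ, mul_zero, add_zero, div_one, endChart_eq hx,
      bumpFlow_of_le t (by rwa [abs_of_pos hx])]

theorem contDiffAt_bumpFlow_one (t : ℝ) :
    ContDiffAt ℝ ∞ (fun p : ℝ × ℝ => bumpFlow p.1 p.2) (t, 1) := by
  have hev : (fun p : ℝ × ℝ => bumpFlow p.1 p.2) =ᶠ[𝓝 (t, 1)] fun p =>
      endChart ((1 - p.2 ^ 2) / p.2 /
        (1 + (1 - p.2 ^ 2) / p.2 * endShift p.1 ((1 - p.2 ^ 2) / p.2))) := by
    have : ∀ᶠ p : ℝ × ℝ in 𝓝 (t, 1), 0 < p.2 :=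
      continuousAt_snd.eventually (lt_mem_nhds one_pos)
    filter_upwards [this] with p hp using bumpFlow_eq_endChart p.1 hp
  refine ContDiffAt.congr_of_eventuallyEq ?_ hev
  have hρ : ContDiffAt ℝ ∞ (fun p : ℝ × ℝ => (1 - p.2 ^ 2) / p.2) (t, 1) :=
    ContDiffAt.div (by fun_prop) (by fun_prop) (by simp)
  have hK : ContDiffAt ℝ ∞ (fun p : ℝ × ℝ => endShift p.1 ((1 - p.2 ^ 2) / p.2)) (t, 1) := by
    refine ContDiffAt.comp (t, 1) (g := fun p : ℝ × ℝ => endShift p.1 p.2)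
      (f := fun p : ℝ × ℝ => (p.1, (1 - p.2 ^ 2) / p.2)) ?_ (contDiffAt_fst.prodMk hρ)
    simpa using contDiffAt_endShift t
  have hX : ContDiff ℝ ∞ endChart := by
    unfold endChart
    refine (ContDiff.add (by fun_prop) (ContDiff.sqrt (by fun_prop) ?_)).div_const 2
    intro x
    positivity
  refine hX.contDiffAt.comp (t, 1) (hρ.div (contDiffAt_const.add (hρ.mul hK)) (by simp))

theorem contDiff_bumpFlow : ContDiff ℝ ∞ fun p : ℝ × ℝ => bumpFlow p.1 p.2 := by
  rw [contDiff_iff_contDiffAt]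
  rintro ⟨t, x⟩
  rcases lt_trichotomy |x| 1 with hx | hx | hx
  · have hev : (fun p : ℝ × ℝ => bumpFlow p.1 p.2) =ᶠ[𝓝 (t, x)] fun p =>
        shrink (dilationFlow p.1 (stretch p.2)) := by
      have : ∀ᶠ p : ℝ × ℝ in 𝓝 (t, x), |p.2| < 1 :=
        (continuous_snd.abs.continuousAt (x := (t, x))).eventually (gt_mem_nhds hx)
      filter_upwards [this] with p hp using bumpFlow_of_lt p.1 hp
    refine ContDiffAt.congr_of_eventuallyEq ?_ hev
    refine contDiff_shrink.contDiffAt.comp (t, x) ?_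
    refine ContDiffAt.comp (t, x) (g := fun p : ℝ × ℝ => dilationFlow p.1 p.2)
      (f := fun p : ℝ × ℝ => (p.1, stretch p.2)) contDiff_dilationFlow.contDiffAt
      (contDiffAt_fst.prodMk ?_)
    unfold stretch
    exact ContDiffAt.div (by fun_prop) (by fun_prop) (one_sub_sq_pos hx).ne'
  · rcases eq_or_eq_neg_of_abs_eq hx with rfl | rfl
    · exact contDiffAt_bumpFlow_one t
    · have : (fun p : ℝ × ℝ => bumpFlow p.1 p.2) = fun p => -bumpFlow p.1 (-p.2) := by
        funext p
        rw [bumpFlow_neg, neg_neg]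
      rw [this]
      refine ContDiffAt.neg (ContDiffAt.comp (t, -1) (g := fun p : ℝ × ℝ => bumpFlow p.1 p.2)
        (f := fun p : ℝ × ℝ => (p.1, -p.2)) ?_ (by fun_prop))
      simpa using contDiffAt_bumpFlow_one t
  · have hev : (fun p : ℝ × ℝ => bumpFlow p.1 p.2) =ᶠ[𝓝 (t, x)] fun p => p.2 := by
      have : ∀ᶠ p : ℝ × ℝ in 𝓝 (t, x), 1 < |p.2| :=
        (continuous_snd.abs.continuousAt (x := (t, x))).eventually (lt_mem_nhds hx)
      filter_upwards [this] with p hp using bumpFlow_of_le p.1 hp.le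
    exact contDiffAt_snd.congr_of_eventuallyEq hev

theorem differentiable_bumpFlow (t : ℝ) : Differentiable ℝ (bumpFlow t) :=
  (contDiff_bumpFlow.comp (f := fun x : ℝ => (t, x)) (by fun_prop)).differentiable (by simp)

theorem hasDerivAt_bumpFlow_zero (t : ℝ) : HasDerivAt (bumpFlow t) (exp (t * log 2)) 0 := by
  have hev : bumpFlow t =ᶠ[𝓝 0] fun x => shrink (dilationFlow t (stretch x)) := by
    have : ∀ᶠ x : ℝ in 𝓝 0, |x| < 1 :=
      (continuous_abs.continuousAt (x := (0 : ℝ))).eventually (gt_mem_nhds (by simp))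
    filter_upwards [this] with x hx using bumpFlow_of_lt t hx
  refine HasDerivAt.congr_of_eventuallyEq ?_ hev
  have h1 : HasDerivAt stretch 1 0 := by
    have := (hasDerivAt_id (0 : ℝ)).div (((hasDerivAt_id (0 : ℝ)).pow 2).const_sub 1) (by simp)
    convert! this using 1
    simp
  have h0 : stretch 0 = 0 := by simp [stretch]
  have h2 : HasDerivAt (dilationFlow t) (exp (t * log 2)) (stretch 0) := by
    rw [h0]
    have h3 := ((((hasDerivAt_sinh (0 : ℝ)).sinh).const_mul (exp (t * log 2))).arsinh).arsinh
    convert! h3 using 1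
    simp
  have h4 : HasDerivAt shrink 1 (dilationFlow t (stretch 0)) := by
    have h5 : dilationFlow t (stretch 0) = 0 := by simp [dilationFlow, h0]
    rw [h5]
    have h6 : HasDerivAt (fun r : ℝ => √(1 + 4 * r ^ 2)) 0 0 := by
      have := ((((hasDerivAt_id (0 : ℝ)).pow 2).const_mul 4).const_add 1).sqrt (by simp)
      simpa using this
    have := ((hasDerivAt_id (0 : ℝ)).const_mul 2).div (h6.const_add 1) (by positivity)
    norm_num at this
    exact this
  convert! h4.comp 0 (h2.comp 0 h1) using 1
  simp

/-- The flow is differentiable and is the identity on a half-line ending at x, so the one-sided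
derivative decides. This includes the ends of the support. -/
theorem hasDerivAt_bumpFlow_of_le {x : ℝ} (t : ℝ) (hx : 1 ≤ |x|) :
    HasDerivAt (bumpFlow t) 1 x := by
  have hd := (differentiable_bumpFlow t x).hasDerivAt
  obtain ⟨s, hs, hxs, hid⟩ : ∃ s : Set ℝ, UniqueDiffWithinAt ℝ s x ∧ x ∈ s ∧
      ∀ y ∈ s, bumpFlow t y = y := by
    rcases le_abs'.1 hx with h | h
    · exact ⟨Iic x, uniqueDiffOn_Iic x x self_mem_Iic, self_mem_Iic, fun y hy =>
        bumpFlow_of_le t (le_abs'.2 (Or.inl ((mem_Iic.1 hy).trans h)))⟩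
    · exact ⟨Ici x, uniqueDiffOn_Ici x x self_mem_Ici, self_mem_Ici, fun y hy =>
        bumpFlow_of_le t (le_abs'.2 (Or.inr (h.trans (mem_Ici.1 hy))))⟩
  have h1 : HasDerivWithinAt (bumpFlow t) 1 s x :=
    (hasDerivWithinAt_id x s).congr hid (hid x hxs)
  rwa [hs.eq_deriv s hd.hasDerivWithinAt h1] at hd

end LineFlow

/-! ### Flows on the circle supported in short arcs -/

section CircleFlow

open Real Filter Topology

/-- The flow `bumpFlow` rescaled to have support `[-1/2, 1/2]`. -/
def angleFlow (t θ : ℝ) : ℝ := bumpFlow t (2 * θ) / 2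

theorem angleFlow_add (s t θ : ℝ) : angleFlow (s + t) θ = angleFlow s (angleFlow t θ) := by
  rw [angleFlow, bumpFlow_add, angleFlow, angleFlow, mul_div_cancel₀ _ (two_ne_zero)]

theorem angleFlow_zero (θ : ℝ) : angleFlow 0 θ = θ := by
  simp [angleFlow, bumpFlow_zero]

theorem angleFlow_of_le {θ : ℝ} (t : ℝ) (h : 1 / 2 ≤ |θ|) : angleFlow t θ = θ := by
  rw [angleFlow, bumpFlow_of_le, mul_div_cancel_left₀ _ (two_ne_zero)]
  rw [abs_mul, abs_two]
  linarith

theorem abs_angleFlow_lt {θ : ℝ} (t : ℝ) (h : |θ| < 1 / 2) : |angleFlow t θ| < 1 / 2 := by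
  have : |2 * θ| < 1 := by
    rw [abs_mul, abs_two]
    linarith
  have := abs_bumpFlow_lt t this
  rw [angleFlow, abs_div, abs_two]
  linarith

theorem angleFlow_at_zero (t : ℝ) : angleFlow t 0 = 0 := by
  have h := bumpFlow_neg t 0
  rw [neg_zero] at h
  have : bumpFlow t 0 = 0 := by linarith
  simp [angleFlow, this]

theorem contDiff_angleFlow : ContDiff ℝ ∞ fun p : ℝ × ℝ => angleFlow p.1 p.2 :=
  (contDiff_bumpFlow.comp (f := fun p : ℝ × ℝ => (p.1, 2 * p.2)) (by fun_prop)).div_const 2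

theorem hasDerivAt_angleFlow_zero (t : ℝ) : HasDerivAt (angleFlow t) (exp (t * log 2)) 0 := by
  have h1 : HasDerivAt (fun θ : ℝ => 2 * θ) (2 * 1) 0 := (hasDerivAt_id (0 : ℝ)).const_mul 2
  have h2 : HasDerivAt (bumpFlow t) (exp (t * log 2)) (2 * 0) := by
    simpa using hasDerivAt_bumpFlow_zero t
  convert! (h2.comp 0 h1).div_const 2 using 1
  ring

theorem hasDerivAt_angleFlow_of_le {θ : ℝ} (t : ℝ) (h : 1 / 2 ≤ |θ|) :
    HasDerivAt (angleFlow t) 1 θ := by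
  have h1 : HasDerivAt (fun θ : ℝ => 2 * θ) (2 * 1) θ := (hasDerivAt_id θ).const_mul 2
  have h2 : HasDerivAt (bumpFlow t) 1 (2 * θ) := by
    apply hasDerivAt_bumpFlow_of_le
    rw [abs_mul, abs_two]
    linarith
  convert! (h2.comp θ h1).div_const 2 using 1
  ring

theorem eq_zero_of_angleFlow_eq {t θ : ℝ} (ht : t ≠ 0) (hθ : |θ| < 1 / 2)
    (h : angleFlow t θ = θ) : θ = 0 := by
  have h1 : |2 * θ| < 1 := by
    rw [abs_mul, abs_two]
    linarith
  have := eq_zero_of_bumpFlow_eq ht h1 (by rw [angleFlow] at h; linarith)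
  linarith

/-- The angle in `(-π, π]` from `p` to `s`. -/
def circleAngle (p s : Circle) : ℝ := Complex.arg ((s * p⁻¹ : Circle) : ℂ)

theorem mul_exp_circleAngle (p s : Circle) : p * Circle.exp (circleAngle p s) = s := by
  rw [circleAngle, Circle.exp_arg, mul_inv_cancel_comm_assoc]

theorem circleAngle_mul_exp {p : Circle} {θ : ℝ} (h1 : -π < θ) (h2 : θ ≤ π) :
    circleAngle p (p * Circle.exp θ) = θ := by
  rw [circleAngle, mul_comm p, mul_inv_cancel_right, Circle.arg_exp h1 h2]

theorem circleAngle_mem (p s : Circle) : circleAngle p s ∈ Ioc (-π) π :=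
  Complex.arg_mem_Ioc _

theorem angleFlow_mem_Ioc {θ : ℝ} (t : ℝ) (h : θ ∈ Ioc (-π) π) : angleFlow t θ ∈ Ioc (-π) π := by
  rcases lt_or_ge |θ| (1 / 2) with h1 | h1
  · have h2 := abs_lt.1 (abs_angleFlow_lt t h1)
    have := pi_gt_three
    constructor <;> linarith
  · rwa [angleFlow_of_le t h1]

/-- The flow on the circle supported in the arc of half-width `1/2` around `p`. -/
def circleFlow (p : Circle) (t : ℝ) (s : Circle) : Circle :=
  p * Circle.exp (angleFlow t (circleAngle p s))

theorem circleAngle_circleFlow (p : Circle) (t : ℝ) (s : Circle) :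
    circleAngle p (circleFlow p t s) = angleFlow t (circleAngle p s) := by
  have h := angleFlow_mem_Ioc t (circleAngle_mem p s)
  exact circleAngle_mul_exp h.1 h.2

theorem circleFlow_mul_exp {p : Circle} {θ : ℝ} (t : ℝ) (h1 : -π < θ) (h2 : θ ≤ π) :
    circleFlow p t (p * Circle.exp θ) = p * Circle.exp (angleFlow t θ) := by
  rw [circleFlow, circleAngle_mul_exp h1 h2]

theorem circleFlow_of_le {p s : Circle} (t : ℝ) (h : 1 / 2 ≤ |circleAngle p s|) :
    circleFlow p t s = s := by
  rw [circleFlow, angleFlow_of_le t h, mul_exp_circleAngle]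

theorem circleFlow_add (p : Circle) (s t : ℝ) (x : Circle) :
    circleFlow p (s + t) x = circleFlow p s (circleFlow p t x) := by
  rw [circleFlow, angleFlow_add, circleFlow, circleAngle_circleFlow]

theorem circleFlow_zero (p x : Circle) : circleFlow p 0 x = x := by
  rw [circleFlow, angleFlow_zero, mul_exp_circleAngle]

theorem continuous_re_mul_inv (p : Circle) :
    Continuous fun s : Circle => ((s * p⁻¹ : Circle) : ℂ).re := by
  fun_prop

theorem circleFlow_of_re_neg {p s : Circle} (t : ℝ) (h : ((s * p⁻¹ : Circle) : ℂ).re < 0) :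
    circleFlow p t s = s := by
  apply circleFlow_of_le
  have h1 : π / 2 < |circleAngle p s| := by
    rw [← not_le, circleAngle, Complex.abs_arg_le_pi_div_two_iff]
    exact h.not_ge
  have := pi_gt_three
  linarith

theorem mem_slitPlane_of_re_nonneg {z : Circle} (h : 0 ≤ (z : ℂ).re) :
    (z : ℂ) ∈ Complex.slitPlane := by
  rcases h.lt_or_eq with h | h
  · exact Or.inl h
  · refine Or.inr fun him => ?_
    exact Circle.coe_ne_zero z (Complex.ext h.symm him)

theorem contDiffAt_arg {z : ℂ} (h : z ∈ Complex.slitPlane) : ContDiffAt ℝ ∞ Complex.arg z := by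
  have h1 : ContDiffAt ℝ ∞ (fun z => (Complex.log z).im) z :=
    Complex.imCLM.contDiff.contDiffAt.comp z ((Complex.contDiffAt_log h).restrict_scalars ℝ)
  simpa [Complex.log_im] using h1

theorem contMDiff_circle_coe : ContMDiff (𝓡 1) 𝓘(ℝ, ℂ) ∞ fun z : Circle => (z : ℂ) :=
  haveI := finrank_real_complex_fact'
  contMDiff_coe_sphere (E := ℂ) (n := 1)

/-- Where Re (s p⁻¹) ≥ 0 the angle is a smooth function, since the cut of `Complex.arg` is avoided;
where Re (s p⁻¹) < 0 the flow is the identity. -/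
theorem contMDiff_circleFlow (p : Circle) :
    ContMDiff (𝓘(ℝ, ℝ).prod (𝓡 1)) (𝓡 1) ∞ fun q : ℝ × Circle => circleFlow p q.1 q.2 := by
  rintro ⟨t, s⟩
  rcases lt_or_ge ((s * p⁻¹ : Circle) : ℂ).re 0 with h | h
  · have hev : (fun q : ℝ × Circle => circleFlow p q.1 q.2) =ᶠ[𝓝 (t, s)] fun q => q.2 := by
      have : ∀ᶠ q : ℝ × Circle in 𝓝 (t, s), ((q.2 * p⁻¹ : Circle) : ℂ).re < 0 :=
        (((continuous_re_mul_inv p).comp continuous_snd).continuousAt (x := (t, s))).eventually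
          (gt_mem_nhds h)
      filter_upwards [this] with q hq using circleFlow_of_re_neg q.1 hq
    exact contMDiffAt_snd.congr_of_eventuallyEq hev
  · have hmul : ContMDiff (𝓘(ℝ, ℝ).prod (𝓡 1)) (𝓡 1) ∞ fun q : ℝ × Circle => q.2 * p⁻¹ :=
      contMDiff_snd.mul contMDiff_const
    have harg : ContMDiffAt (𝓘(ℝ, ℝ).prod (𝓡 1)) 𝓘(ℝ, ℝ) ∞
        (fun q : ℝ × Circle => circleAngle p q.2) (t, s) :=
      ContMDiffAt.comp (I' := 𝓘(ℝ, ℂ)) (t, s) (g := Complex.arg)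
        (f := fun q : ℝ × Circle => ((q.2 * p⁻¹ : Circle) : ℂ))
        (contDiffAt_arg (mem_slitPlane_of_re_nonneg h)).contMDiffAt
        (contMDiff_circle_coe.comp hmul).contMDiffAt
    have hflow : ContMDiffAt (𝓘(ℝ, ℝ).prod (𝓡 1)) 𝓘(ℝ, ℝ) ∞
        (fun q : ℝ × Circle => angleFlow q.1 (circleAngle p q.2)) (t, s) :=
      ContMDiffAt.comp (I' := 𝓘(ℝ, ℝ × ℝ)) (t, s) (g := fun r : ℝ × ℝ => angleFlow r.1 r.2)
        (f := fun q : ℝ × Circle => (q.1, circleAngle p q.2))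
        contDiff_angleFlow.contMDiff.contMDiffAt (contMDiffAt_fst.prodMk_space harg)
    exact contMDiffAt_const.mul (contMDiff_circleExp.contMDiffAt.comp (t, s) hflow)

theorem contMDiff_circleFlow_right (p : Circle) (t : ℝ) :
    ContMDiff (𝓡 1) (𝓡 1) ∞ (circleFlow p t) :=
  ContMDiff.comp (I' := 𝓘(ℝ, ℝ).prod (𝓡 1)) (g := fun q : ℝ × Circle => circleFlow p q.1 q.2)
    (f := fun s => (t, s)) (contMDiff_circleFlow p) (contMDiff_const.prodMk contMDiff_id)

/-- The time-`t` map of `circleFlow` as a diffeomorphism. -/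
def circleDiffeo (p : Circle) (t : ℝ) : Diff (𝓡 1) Circle where
  toFun := circleFlow p t
  invFun := circleFlow p (-t)
  left_inv s := by rw [← circleFlow_add, neg_add_cancel, circleFlow_zero]
  right_inv s := by rw [← circleFlow_add, add_neg_cancel, circleFlow_zero]
  contMDiff_toFun := contMDiff_circleFlow_right p t
  contMDiff_invFun := contMDiff_circleFlow_right p (-t)

theorem circleDiffeo_apply (p : Circle) (t : ℝ) (s : Circle) :
    circleDiffeo p t s = circleFlow p t s := rfl

theorem isSmoothFlow_circleDiffeo (p : Circle) : IsSmoothFlow (circleDiffeo p) where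
  map_add s t := Diffeomorph.ext fun x => circleFlow_add p s t x
  smooth := contMDiff_circleFlow p

/-- From cos θ ≥ 1 - θ²/2. The closed condition on the real part survives the closure in
`flowSupport`, and 2 (7/8)² > 1 still separates adjacent quarter points. -/
theorem seven_eighths_le_re {p s : Circle} (h : |circleAngle p s| < 1 / 2) :
    7 / 8 ≤ ((s * p⁻¹ : Circle) : ℂ).re := by
  have h1 : ((s * p⁻¹ : Circle) : ℂ).re = cos (circleAngle p s) := by
    rw [← Complex.exp_ofReal_mul_I_re, ← Circle.coe_exp, circleAngle, Circle.exp_arg]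
  rw [h1]
  have h2 := one_sub_sq_div_two_le_cos (x := circleAngle p s)
  have h3 : circleAngle p s ^ 2 ≤ (1 / 2) ^ 2 := sq_le_sq' (abs_lt.1 h).1.le (abs_lt.1 h).2.le
  linarith

theorem flowSupport_circleDiffeo_subset (p : Circle) :
    flowSupport (circleDiffeo p) ⊆ {s | 7 / 8 ≤ ((s * p⁻¹ : Circle) : ℂ).re} := by
  refine closure_minimal ?_ (isClosed_le continuous_const (continuous_re_mul_inv p))
  rintro s ⟨t, ht⟩
  refine seven_eighths_le_re (not_le.1 fun h => ht ?_)
  exact circleFlow_of_le t h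

/-! ### Multipliers of fixed points -/

/-- The curve `θ ↦ p e^{iθ}` on the circle. -/
def circleCurve (p : Circle) (θ : ℝ) : Circle := p * Circle.exp θ

theorem contMDiff_circleCurve (p : Circle) : ContMDiff 𝓘(ℝ, ℝ) (𝓡 1) ∞ (circleCurve p) :=
  contMDiff_const.mul contMDiff_circleExp

theorem hasDerivAt_coe_circleCurve (p : Circle) (θ : ℝ) :
    HasDerivAt (fun x => (circleCurve p x : ℂ)) (p * (Circle.exp θ * Complex.I)) θ := by
  have h1 : HasDerivAt (fun x : ℝ => Complex.exp (x * Complex.I))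
      (Complex.exp (θ * Complex.I) * (1 * Complex.I)) θ :=
    ((hasDerivAt_id (θ : ℝ)).ofReal_comp.mul_const Complex.I).cexp
  rw [one_mul] at h1
  exact h1.const_mul (p : ℂ)

/-- The velocity of `circleCurve`. -/
def circleVelocity (p : Circle) (θ : ℝ) : EuclideanSpace ℝ (Fin 1) :=
  (mfderiv 𝓘(ℝ, ℝ) (𝓡 1) (circleCurve p) θ : ℝ →L[ℝ] EuclideanSpace ℝ (Fin 1)) 1

theorem mdifferentiableAt_circleCurve (p : Circle) (θ : ℝ) :
    MDifferentiableAt 𝓘(ℝ, ℝ) (𝓡 1) (circleCurve p) θ :=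
  (contMDiff_circleCurve p).mdifferentiable (by simp) θ

theorem mfderiv_coe_circleVelocity (p : Circle) (θ : ℝ) :
    (mfderiv (𝓡 1) 𝓘(ℝ, ℂ) (fun z : Circle => (z : ℂ)) (circleCurve p θ) :
      EuclideanSpace ℝ (Fin 1) →L[ℝ] ℂ) (circleVelocity p θ) =
      (p : ℂ) * ((Circle.exp θ : ℂ) * Complex.I) := by
  have h1 := mfderiv_comp (I := 𝓘(ℝ, ℝ)) (I' := 𝓡 1) (I'' := 𝓘(ℝ, ℂ)) θ
    (g := (fun z : Circle => (z : ℂ))) (f := circleCurve p)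
    (contMDiff_circle_coe.mdifferentiable (by simp) _) (mdifferentiableAt_circleCurve p θ)
  rw [mfderiv_eq_fderiv] at h1
  have h2 := (hasDerivAt_coe_circleCurve p θ).hasFDerivAt.fderiv
  have h3 := congrArg (fun L : ℝ →L[ℝ] ℂ => L 1) (h1.symm.trans h2)
  simp only [ContinuousLinearMap.toSpanSingleton_apply, one_smul] at h3
  exact h3

theorem circleVelocity_ne_zero (p : Circle) (θ : ℝ) : circleVelocity p θ ≠ 0 := by
  intro h
  have h1 : ∀ (L : EuclideanSpace ℝ (Fin 1) →L[ℝ] ℂ) {c : ℂ}, L (circleVelocity p θ) = c →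
      c = 0 := fun L c hc => by rw [← hc, h, map_zero]
  exact mul_ne_zero (Circle.coe_ne_zero _) (mul_ne_zero (Circle.coe_ne_zero _) Complex.I_ne_zero)
    (h1 _ (mfderiv_coe_circleVelocity p θ))

theorem exists_smul_eq_of_ne_zero {ξ : EuclideanSpace ℝ (Fin 1)} (hξ : ξ ≠ 0)
    (v : EuclideanSpace ℝ (Fin 1)) : ∃ c : ℝ, c • ξ = v := by
  have h0 : ξ 0 ≠ 0 := fun h => hξ (by ext i; fin_cases i; simpa using h)
  refine ⟨v 0 / ξ 0, ?_⟩
  ext i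
  fin_cases i
  simp [h0]

/-- If `g` reads as `φ` in the angular coordinate, then its multiplier is that of `φ`. -/
theorem isFixedWithMultiplier_of_eventuallyEq {g : Diff (𝓡 1) Circle} {p : Circle} {θ c : ℝ}
    {φ : ℝ → ℝ} (hφ : HasDerivAt φ c θ) (hθ : φ θ = θ)
    (h : ∀ᶠ x in 𝓝 θ, g (circleCurve p x) = circleCurve p (φ x)) :
    IsFixedWithMultiplier g (circleCurve p θ) c := by
  refine ⟨by rw [h.self_of_nhds, hθ], fun v => ?_⟩
  have h1 : mfderiv 𝓘(ℝ, ℝ) (𝓡 1) (g ∘ circleCurve p) θ =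
      (mfderiv (𝓡 1) (𝓡 1) g (circleCurve p θ)).comp
        (mfderiv 𝓘(ℝ, ℝ) (𝓡 1) (circleCurve p) θ) :=
    mfderiv_comp θ (g.mdifferentiable (by simp) _) (mdifferentiableAt_circleCurve p θ)
  have hφm : HasMFDerivAt 𝓘(ℝ, ℝ) 𝓘(ℝ, ℝ) φ θ (ContinuousLinearMap.toSpanSingleton ℝ c) :=
    hφ.hasFDerivAt.hasMFDerivAt
  have hcurve : MDifferentiableAt 𝓘(ℝ, ℝ) (𝓡 1) (circleCurve p) (φ θ) :=
    mdifferentiableAt_circleCurve p (φ θ)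
  have h2 : mfderiv 𝓘(ℝ, ℝ) (𝓡 1) (circleCurve p ∘ φ) θ =
      (mfderiv 𝓘(ℝ, ℝ) (𝓡 1) (circleCurve p) (φ θ)).comp (mfderiv 𝓘(ℝ, ℝ) 𝓘(ℝ, ℝ) φ θ) :=
    mfderiv_comp θ hcurve hφm.mdifferentiableAt
  have h3 : mfderiv 𝓘(ℝ, ℝ) (𝓡 1) (g ∘ circleCurve p) θ =
      mfderiv 𝓘(ℝ, ℝ) (𝓡 1) (circleCurve p ∘ φ) θ := Filter.EventuallyEq.mfderiv_eq h
  rw [hφm.mfderiv] at h2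
  have h4 : (mfderiv (𝓡 1) (𝓡 1) g (circleCurve p θ) :
      EuclideanSpace ℝ (Fin 1) →L[ℝ] EuclideanSpace ℝ (Fin 1)) (circleVelocity p θ) =
      c • circleVelocity p (φ θ) := by
    have h5 := congrArg (fun L : ℝ →L[ℝ] EuclideanSpace ℝ (Fin 1) => L 1)
      (h1.symm.trans (h3.trans h2))
    have h6 : ∀ L : ℝ →L[ℝ] EuclideanSpace ℝ (Fin 1),
        L (ContinuousLinearMap.toSpanSingleton ℝ c 1) = c • L 1 := fun L => by
      rw [← map_smul]
      simp
    exact h5.trans (h6 _)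
  rw [hθ] at h4
  obtain ⟨a, rfl⟩ := exists_smul_eq_of_ne_zero (circleVelocity_ne_zero p θ) v
  have h7 : ∀ L : EuclideanSpace ℝ (Fin 1) →L[ℝ] EuclideanSpace ℝ (Fin 1),
      L (circleVelocity p θ) = c • circleVelocity p θ →
      L (a • circleVelocity p θ) = c • a • circleVelocity p θ := fun L hL => by
    rw [map_smul, hL, smul_comm]
  exact h7 _ h4

theorem isFixedWithMultiplier_unique {g : Diff (𝓡 1) Circle} {q : Circle} {c d : ℝ}
    (hc : IsFixedWithMultiplier g q c) (hd : IsFixedWithMultiplier g q d) : c = d := by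
  have hξ := circleVelocity_ne_zero 1 0
  have h := (hc.2 (circleVelocity 1 0)).symm.trans (hd.2 _)
  exact smul_left_injective ℝ hξ h

theorem isFixedWithMultiplier_circleDiffeo_self (p : Circle) (t : ℝ) :
    IsFixedWithMultiplier (circleDiffeo p t) p (exp (t * log 2)) := by
  have h := isFixedWithMultiplier_of_eventuallyEq (g := circleDiffeo p t) (p := p)
    (hasDerivAt_angleFlow_zero t) (angleFlow_at_zero t) (by
      filter_upwards [Ioo_mem_nhds (neg_lt_zero.2 pi_pos) pi_pos] with x hx
      exact circleFlow_mul_exp t hx.1 hx.2.le)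
  simpa [circleCurve] using h

/-- This rules out hyperbolic fixed points away from p. The ends of the arc are the delicate case,
settled by the one-sided derivative of `angleFlow`. -/
theorem isFixedWithMultiplier_one_of_le {p q : Circle} (t : ℝ) (h : 1 / 2 ≤ |circleAngle p q|) :
    IsFixedWithMultiplier (circleDiffeo p t) q 1 := by
  rcases lt_or_ge ((q * p⁻¹ : Circle) : ℂ).re 0 with hre | hre
  · have hev : (circleDiffeo p t : Circle → Circle) =ᶠ[𝓝 q] id := by
      filter_upwards [(continuous_re_mul_inv p).continuousAt.eventually (gt_mem_nhds hre)]
        with s hs using circleFlow_of_re_neg t hs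
    refine ⟨hev.self_of_nhds, fun v => ?_⟩
    rw [hev.mfderiv_eq, mfderiv_id, one_smul]
    rfl
  · have hlt : |circleAngle p q| < π :=
      lt_of_le_of_lt (Complex.abs_arg_le_pi_div_two_iff.2 hre) (by linarith [pi_pos])
    have h1 := isFixedWithMultiplier_of_eventuallyEq (g := circleDiffeo p t) (p := p)
      (hasDerivAt_angleFlow_of_le t h) (angleFlow_of_le t h) (by
        filter_upwards [Ioo_mem_nhds (abs_lt.1 hlt).1 (abs_lt.1 hlt).2] with x hx
        exact circleFlow_mul_exp t hx.1 hx.2.le)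
    rwa [circleCurve, mul_exp_circleAngle] at h1

theorem isHyperbolicRepelling_circleDiffeo_iff {p q : Circle} {t : ℝ} (ht : 0 < t) :
    IsHyperbolicRepelling (circleDiffeo p t) q ↔ q = p := by
  constructor
  · rintro ⟨c, hc, h⟩
    rcases lt_or_ge |circleAngle p q| (1 / 2) with h1 | h1
    · have h2 := circleAngle_circleFlow p t q
      rw [← circleDiffeo_apply, h.1] at h2
      have h3 := eq_zero_of_angleFlow_eq ht.ne' h1 h2.symm
      rw [← mul_exp_circleAngle p q, h3, Circle.exp_zero, mul_one]
    · rw [isFixedWithMultiplier_unique h (isFixedWithMultiplier_one_of_le t h1), abs_one] at hc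
      exact absurd hc (lt_irrefl _)
  · rintro rfl
    refine ⟨_, ?_, isFixedWithMultiplier_circleDiffeo_self q t⟩
    rw [abs_of_pos (exp_pos _), one_lt_exp_iff]
    exact mul_pos ht (log_pos one_lt_two)

/-! ### Four commuting flows and their product -/

/-- The four points `1, i, -1, -i` of the circle. -/
def quarterPoint (i : Fin 4) : Circle := Circle.exp (i.val * (π / 2))

theorem re_mul_inv_quarterPoint (i : Fin 4) (s : Circle) :
    ((s * (quarterPoint i)⁻¹ : Circle) : ℂ).re =
      ![(s : ℂ).re, (s : ℂ).im, -(s : ℂ).re, -(s : ℂ).im] i := by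
  have h2 : (2 : ℝ) * (π / 2) = π := by ring
  have h3 : (3 : ℝ) * (π / 2) = 2 * π - π / 2 := by ring
  rw [Circle.coe_mul, Circle.coe_inv_eq_conj, Complex.mul_re, quarterPoint, Circle.coe_exp,
    Complex.conj_re, Complex.conj_im, Complex.exp_ofReal_mul_I_re, Complex.exp_ofReal_mul_I_im]
  fin_cases i <;> simp [h2, h3, cos_two_pi_sub, sin_two_pi_sub]

/-- The flows around the four points `1, i, -1, -i`. -/
def quarterFlow (i : Fin 4) : ℝ → Diff (𝓡 1) Circle := circleDiffeo (quarterPoint i)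

theorem disjoint_arcs {i j : Fin 4} (hij : i ≠ j) {s : Circle}
    (hi : 7 / 8 ≤ ((s * (quarterPoint i)⁻¹ : Circle) : ℂ).re)
    (hj : 7 / 8 ≤ ((s * (quarterPoint j)⁻¹ : Circle) : ℂ).re) : False := by
  have h := Circle.normSq_coe s
  rw [Complex.normSq_apply] at h
  rw [re_mul_inv_quarterPoint] at hi hj
  fin_cases i <;> fin_cases j <;> first | exact hij rfl | skip
  all_goals
    simp at hi hj
    nlinarith

theorem isFlowQuadruple_quarterFlow : IsFlowQuadruple quarterFlow where
  flow i := isSmoothFlow_circleDiffeo _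
  disjoint i j hij := Set.disjoint_left.2 fun s hi hj =>
    disjoint_arcs hij (flowSupport_circleDiffeo_subset _ hi) (flowSupport_circleDiffeo_subset _ hj)
  repelling i := by
    refine ⟨quarterPoint i, ?_, fun t ht q => isHyperbolicRepelling_circleDiffeo_iff ht⟩
    have h := isFixedWithMultiplier_circleDiffeo_self (quarterPoint i) 1
    rwa [one_mul, exp_log two_pos] at h

theorem quarterFlow_apply_eq_self {i j : Fin 4} (hij : i ≠ j) {s : Circle} (t : ℝ)
    (hs : |circleAngle (quarterPoint i) s| < 1 / 2) : quarterFlow j t s = s := by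
  refine circleFlow_of_le t (not_lt.1 fun h => ?_)
  exact disjoint_arcs hij (seven_eighths_le_re hs) (seven_eighths_le_re h)

theorem commute_quarterFlow {i j : Fin 4} (hij : i ≠ j) (s t : ℝ) :
    Commute (quarterFlow i s) (quarterFlow j t) := by
  have h : Equiv.Perm.Disjoint (quarterFlow i s).toEquiv (quarterFlow j t).toEquiv := by
    intro x
    rcases lt_or_ge |circleAngle (quarterPoint i) x| (1 / 2) with h1 | h1
    · exact Or.inr (quarterFlow_apply_eq_self hij t h1)
    · exact Or.inl (circleFlow_of_le s h1)
  exact Diffeomorph.ext fun x => congrArg (fun e : Equiv.Perm Circle => e x) h.commute.eq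

/-- Diffeomorphisms with disjoint supports commute, so the factors of the two products can be
interleaved and merged flow by flow. -/
theorem flowProduct_add (v w : EuclideanSpace ℝ (Fin (3 + 1))) :
    flowProduct quarterFlow (v + w) = flowProduct quarterFlow v * flowProduct quarterFlow w := by
  have hadd : ∀ i, quarterFlow i ((v + w) i) = quarterFlow i (v i) * quarterFlow i (w i) :=
    fun i => (isSmoothFlow_circleDiffeo _).map_add _ _
  have hc : ∀ {i j : Fin 4}, i ≠ j → Commute (quarterFlow i (v i)) (quarterFlow j (w j)) :=
    fun hij => commute_quarterFlow hij _ _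
  have hc' : ∀ {i j : Fin 4}, i ≠ j → Commute (quarterFlow i (w i)) (quarterFlow j (v j)) :=
    fun hij => commute_quarterFlow hij _ _
  simp only [flowProduct, hadd]
  have h1 : Commute (quarterFlow 0 (w 0)) (quarterFlow 1 (v 1)) := hc' (by decide)
  have h2 : Commute (quarterFlow 0 (w 0) * quarterFlow 1 (w 1)) (quarterFlow 2 (v 2)) :=
    (hc' (by decide)).mul_left (hc' (by decide))
  have h3 : Commute (quarterFlow 0 (w 0) * quarterFlow 1 (w 1) * quarterFlow 2 (w 2))
      (quarterFlow 3 (v 3)) :=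
    ((hc' (by decide)).mul_left (hc' (by decide))).mul_left (hc' (by decide))
  rw [h1.mul_mul_mul_comm, h2.mul_mul_mul_comm, h3.mul_mul_mul_comm]

theorem flowProduct_zero : flowProduct quarterFlow 0 = 1 := by
  have h := flowProduct_add 0 0
  rw [add_zero] at h
  exact (left_eq_mul.1 h)

/-- Only the first flow moves points of the arc around its repelling point; this makes the fibre
derivative there depend on the first coordinate alone. -/
theorem flowProduct_circleCurve (v : EuclideanSpace ℝ (Fin (3 + 1))) {θ : ℝ} (h : |θ| < 1 / 2) :
    flowProduct quarterFlow v (circleCurve (quarterPoint 0) θ) =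
      circleCurve (quarterPoint 0) (angleFlow (v 0) θ) := by
  have hpi := pi_gt_three
  have h1 := abs_lt.1 h
  have hθ : |circleAngle (quarterPoint 0) (circleCurve (quarterPoint 0) θ)| < 1 / 2 := by
    rwa [circleCurve, circleAngle_mul_exp (by linarith) (by linarith)]
  simp only [flowProduct, Diff.mul_apply]
  rw [quarterFlow_apply_eq_self (i := 0) (by decide) _ hθ,
    quarterFlow_apply_eq_self (i := 0) (by decide) _ hθ,
    quarterFlow_apply_eq_self (i := 0) (by decide) _ hθ]
  exact circleFlow_mul_exp _ (by linarith) (by linarith)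

theorem contMDiff_flowProduct :
    ContMDiff (𝓘(ℝ, EuclideanSpace ℝ (Fin (3 + 1))).prod (𝓡 1)) (𝓡 1) ∞
      fun q : EuclideanSpace ℝ (Fin (3 + 1)) × Circle => flowProduct quarterFlow q.1 q.2 := by
  have hstep : ∀ (i : Fin 4) {g : EuclideanSpace ℝ (Fin (3 + 1)) × Circle → Circle},
      ContMDiff (𝓘(ℝ, EuclideanSpace ℝ (Fin (3 + 1))).prod (𝓡 1)) (𝓡 1) ∞ g →
      ContMDiff (𝓘(ℝ, EuclideanSpace ℝ (Fin (3 + 1))).prod (𝓡 1)) (𝓡 1) ∞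
        fun q => quarterFlow i (q.1 i) (g q) := by
    intro i g hg
    have hi : ContMDiff 𝓘(ℝ, EuclideanSpace ℝ (Fin (3 + 1))) 𝓘(ℝ, ℝ) ∞
        fun v : EuclideanSpace ℝ (Fin (3 + 1)) => v i :=
      (EuclideanSpace.proj i : EuclideanSpace ℝ (Fin (3 + 1)) →L[ℝ] ℝ).contDiff.contMDiff
    have hpair : ContMDiff (𝓘(ℝ, EuclideanSpace ℝ (Fin (3 + 1))).prod (𝓡 1))
        (𝓘(ℝ, ℝ).prod (𝓡 1)) ∞
        fun q : EuclideanSpace ℝ (Fin (3 + 1)) × Circle => (q.1 i, g q) :=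
      (hi.comp contMDiff_fst).prodMk hg
    exact ContMDiff.comp (I' := 𝓘(ℝ, ℝ).prod (𝓡 1))
      (g := fun q : ℝ × Circle => circleFlow (quarterPoint i) q.1 q.2)
      (f := fun q : EuclideanSpace ℝ (Fin (3 + 1)) × Circle => (q.1 i, g q))
      (contMDiff_circleFlow (quarterPoint i)) hpair
  have h3 := hstep 3 (g := fun q => q.2) contMDiff_snd
  have h2 := hstep 2 h3
  have h1 := hstep 1 h2
  simp only [flowProduct, Diff.mul_apply]
  exact hstep 0 h1

end CircleFlow

/-! ### Riemannian metrics and norms of derivatives -/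

section Metrics

open Filter Topology

variable {E : Type*} [NormedAddCommGroup E] [NormedSpace ℝ E]
  {H : Type*} [TopologicalSpace H] {I : ModelWithCorners ℝ E H}
  {M : Type*} [TopologicalSpace M] [ChartedSpace H M] [IsManifold I 1 M]

theorem SmoothMetric.nonneg (m : SmoothMetric I M) (x : M) (v : TangentSpace I x) :
    0 ≤ m.inner x v v := by
  rcases eq_or_ne v 0 with rfl | hv
  · simp
  · exact (m.pos x v hv).le

/-- Near `x₀`, the metric is bounded above by the norm in the trivialization at `x₀`. -/
theorem SmoothMetric.eventually_inner_le (m : SmoothMetric I M) (x₀ : M) :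
    ∃ C > 0, ∀ᶠ x in 𝓝 x₀, ∀ v : TangentSpace I x, m.inner x v v ≤
      C * ‖(trivializationAt E (fun x : M => TangentSpace I x) x₀).continuousLinearMapAt
        ℝ x v‖ ^ 2 := by
  let m' := m.toContinuousRiemannianMetric
  let _ : RiemannianBundle (fun x : M => TangentSpace I x) := ⟨m'.toRiemannianMetric⟩
  obtain ⟨C, hC, h⟩ := eventually_norm_symmL_trivializationAt_lt E
    (fun x : M => TangentSpace I x) x₀
  refine ⟨C ^ 2, by positivity, ?_⟩
  filter_upwards [h, (trivializationAt E (fun x : M => TangentSpace I x) x₀).open_baseSet.mem_nhds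
    (FiberBundle.mem_baseSet_trivializationAt' x₀)] with x hx hmem v
  have h1 : m.inner x v v = ‖v‖ ^ 2 := real_inner_self_eq_norm_sq v
  have h2 : (trivializationAt E (fun x : M => TangentSpace I x) x₀).symmL ℝ x
      ((trivializationAt E (fun x : M => TangentSpace I x) x₀).continuousLinearMapAt ℝ x v) = v :=
    Trivialization.symmL_continuousLinearMapAt _ hmem v
  rw [h1, ← mul_pow]
  refine pow_le_pow_left₀ (norm_nonneg _) ?_ 2
  calc ‖v‖ = _ := by rw [← congrArg norm h2]
    _ ≤ _ := (ContinuousLinearMap.le_opNorm _ _).trans (by gcongr)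

/-- Near `x₀`, the metric is bounded below by the norm in the trivialization at `x₀`. -/
theorem SmoothMetric.eventually_le_inner (m : SmoothMetric I M) (x₀ : M) :
    ∃ C > 0, ∀ᶠ x in 𝓝 x₀, ∀ v : TangentSpace I x,
      ‖(trivializationAt E (fun x : M => TangentSpace I x) x₀).continuousLinearMapAt
        ℝ x v‖ ^ 2 ≤ C * m.inner x v v := by
  let m' := m.toContinuousRiemannianMetric
  let _ : RiemannianBundle (fun x : M => TangentSpace I x) := ⟨m'.toRiemannianMetric⟩
  obtain ⟨C, hC, h⟩ := eventually_norm_trivializationAt_lt E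
    (fun x : M => TangentSpace I x) x₀
  refine ⟨C ^ 2, by positivity, ?_⟩
  filter_upwards [h] with x hx v
  have h1 : m.inner x v v = ‖v‖ ^ 2 := real_inner_self_eq_norm_sq v
  rw [h1, ← mul_pow]
  exact pow_le_pow_left₀ (norm_nonneg _)
    ((ContinuousLinearMap.le_opNorm _ _).trans (by gcongr)) 2

/-- Any two smooth metrics on a compact manifold are comparable. -/
theorem SmoothMetric.exists_inner_le [CompactSpace M] (m m' : SmoothMetric I M) :
    ∃ C > 0, ∀ (x : M) (v : TangentSpace I x), m.inner x v v ≤ C * m'.inner x v v := by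
  have hloc : ∀ x₀ : M, ∃ C > 0, ∀ᶠ x in 𝓝 x₀, ∀ v : TangentSpace I x,
      m.inner x v v ≤ C * m'.inner x v v := by
    intro x₀
    obtain ⟨C, hC, h⟩ := m.eventually_inner_le x₀
    obtain ⟨C', hC', h'⟩ := m'.eventually_le_inner x₀
    refine ⟨C * C', by positivity, ?_⟩
    filter_upwards [h, h'] with x hx hx' v
    rw [mul_assoc]
    exact (hx v).trans (by gcongr; exact hx' v)
  choose C hC h using hloc
  obtain ⟨t, ht⟩ := CompactSpace.elim_nhds_subcover
    (fun x₀ => {x | ∀ v : TangentSpace I x, m.inner x v v ≤ C x₀ * m'.inner x v v}) h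
  have hsum : 0 ≤ ∑ y ∈ t, C y := Finset.sum_nonneg fun y _ => (hC y).le
  refine ⟨1 + ∑ y ∈ t, C y, by linarith, fun x v => ?_⟩
  have hx : x ∈ ⋃ y ∈ t, {x | ∀ v : TangentSpace I x, m.inner x v v ≤ C y * m'.inner x v v} := by
    rw [ht]
    trivial
  obtain ⟨y, hy, hxy⟩ := mem_iUnion₂.1 hx
  refine (hxy v).trans (mul_le_mul_of_nonneg_right ?_ (m'.nonneg x v))
  have := Finset.single_le_sum (fun y _ => (hC y).le) hy
  linarith

/-- The derivative of `g` expands the metric `m` by at most the factor `K`. -/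
def DerivBound (m : SmoothMetric I M) (g : Diff I M) (K : ℝ) : Prop :=
  ∀ (x : M) (v : TangentSpace I x),
    m.inner (g x) (mfderiv I I g x v) (mfderiv I I g x v) ≤ K ^ 2 * m.inner x v v

/-- By homogeneity the bound on the unit ball is a quadratic inequality for all vectors, which lets
later estimates stay in ℝ. -/
theorem derivNormAt_le_iff {m : SmoothMetric I M} {g : Diff I M} {x : M} {K : ℝ} (hK : 0 ≤ K) :
    derivNormAt m g x ≤ ENNReal.ofReal K ↔ ∀ v : TangentSpace I x,
      m.inner (g x) (mfderiv I I g x v) (mfderiv I I g x v) ≤ K ^ 2 * m.inner x v v := by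
  have hle : ∀ a : ℝ, ENNReal.ofReal (Real.sqrt a) ≤ ENNReal.ofReal K ↔ a ≤ K ^ 2 := fun a => by
    rw [ENNReal.ofReal_le_ofReal_iff hK, Real.sqrt_le_left hK]
  simp only [derivNormAt, iSup_le_iff, hle]
  constructor
  · intro h v
    rcases eq_or_ne v 0 with rfl | hv
    · simp
    · have hpos := m.pos x v hv
      have h1 := h ((Real.sqrt (m.inner x v v))⁻¹ • v) (by
        simp only [map_smul, smul_apply, smul_eq_mul]
        rw [← mul_assoc, ← mul_inv, Real.mul_self_sqrt hpos.le, inv_mul_cancel₀ hpos.ne'])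
      simp only [map_smul, smul_apply, smul_eq_mul] at h1
      rw [← mul_assoc, ← mul_inv, Real.mul_self_sqrt hpos.le, inv_mul_le_iff₀ hpos] at h1
      linarith
  · intro h v hv
    exact (h v).trans (mul_le_of_le_one_right (sq_nonneg K) hv)

theorem derivNorm_le_iff {m : SmoothMetric I M} {g : Diff I M} {K : ℝ} (hK : 0 ≤ K) :
    derivNorm m g ≤ ENNReal.ofReal K ↔ DerivBound m g K ∧ DerivBound m g⁻¹ K := by
  simp only [derivNorm, iSup_le_iff, max_le_iff, derivNormAt_le_iff hK, DerivBound, forall_and]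

theorem Diff.mfderiv_mul (g h : Diff I M) (x : M) (v : TangentSpace I x) :
    mfderiv I I (g * h : Diff I M) x v = mfderiv I I g (h x) (mfderiv I I h x v) := by
  have h1 : mfderiv I I (g ∘ h) x = (mfderiv I I g (h x)).comp (mfderiv I I h x) :=
    mfderiv_comp x (g.mdifferentiable (by simp) _) (h.mdifferentiable (by simp) _)
  exact congrArg (fun L : TangentSpace I x →L[ℝ] TangentSpace I (g (h x)) => L v) h1

theorem Diff.mfderiv_one (x : M) (v : TangentSpace I x) :
    mfderiv I I (1 : Diff I M) x v = v := by
  have h1 : mfderiv I I (id : M → M) x = ContinuousLinearMap.id ℝ (TangentSpace I x) := mfderiv_id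
  exact congrArg (fun L : TangentSpace I x →L[ℝ] TangentSpace I x => L v) h1

theorem DerivBound.mul {m : SmoothMetric I M} {g h : Diff I M} {K L : ℝ}
    (hg : DerivBound m g K) (hh : DerivBound m h L) : DerivBound m (g * h) (K * L) := by
  intro x v
  rw [Diff.mfderiv_mul, mul_pow, mul_assoc]
  exact (hg (h x) _).trans (mul_le_mul_of_nonneg_left (hh x v) (sq_nonneg K))

theorem DerivBound.one (m : SmoothMetric I M) : DerivBound m 1 1 := by
  intro x v
  rw [Diff.mfderiv_one, one_pow, one_mul]
  exact le_rfl

theorem derivNorm_mul_le {m : SmoothMetric I M} {g h : Diff I M} {K L : ℝ} (hK : 0 ≤ K)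
    (hL : 0 ≤ L) (hg : derivNorm m g ≤ ENNReal.ofReal K) (hh : derivNorm m h ≤ ENNReal.ofReal L) :
    derivNorm m (g * h) ≤ ENNReal.ofReal (K * L) := by
  rw [derivNorm_le_iff hK] at hg
  rw [derivNorm_le_iff hL] at hh
  rw [derivNorm_le_iff (mul_nonneg hK hL), mul_inv_rev]
  refine ⟨hg.1.mul hh.1, ?_⟩
  rw [mul_comm K L]
  exact hh.2.mul hg.2

theorem derivNorm_one_le (m : SmoothMetric I M) : derivNorm m 1 ≤ ENNReal.ofReal 1 := by
  rw [derivNorm_le_iff zero_le_one, inv_one]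
  exact ⟨.one m, .one m⟩

theorem derivNorm_list_prod_le {m : SmoothMetric I M} {K : ℝ} (hK : 0 ≤ K) (L : List (Diff I M))
    (h : ∀ g ∈ L, derivNorm m g ≤ ENNReal.ofReal K) :
    derivNorm m L.prod ≤ ENNReal.ofReal (K ^ L.length) := by
  induction L with
  | nil => simpa using derivNorm_one_le m
  | cons g L ih =>
    rw [List.prod_cons, List.length_cons, pow_succ']
    exact derivNorm_mul_le hK (pow_nonneg hK _) (h g List.mem_cons_self)
      (ih fun g' hg' => h g' (List.mem_cons_of_mem _ hg'))

theorem PreservesMetric.derivBound {m : SmoothMetric I M} {g : Diff I M}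
    (h : PreservesMetric m g) : DerivBound m g 1 := by
  intro x v
  rw [h x v v, one_pow, one_mul]

theorem PreservesMetric.mul {m : SmoothMetric I M} {g h : Diff I M}
    (hg : PreservesMetric m g) (hh : PreservesMetric m h) : PreservesMetric m (g * h) := by
  intro x v w
  rw [Diff.mfderiv_mul, Diff.mfderiv_mul]
  exact (hg _ _ _).trans (hh _ _ _)

theorem PreservesMetric.inv {m : SmoothMetric I M} {g : Diff I M}
    (hg : PreservesMetric m g) : PreservesMetric m g⁻¹ := by
  -- The points y and g (g⁻¹ y) give different tangent space types, so the identity enters as a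
  -- variable h with h = 1.
  have key : ∀ (y : M) (v : TangentSpace I y) (w : TangentSpace I y), ∀ h : Diff I M, h = 1 →
      m.inner (h y) (mfderiv I I h y v) (mfderiv I I h y w) = m.inner y v w := by
    rintro y v w h rfl
    rw [Diff.mfderiv_one, Diff.mfderiv_one]
    rfl
  intro x v w
  have h1 := key x v w (g * g⁻¹) (mul_inv_cancel g)
  rw [Diff.mfderiv_mul, Diff.mfderiv_mul] at h1
  exact (hg _ _ _).symm.trans h1

/-- The diffeomorphisms preserving a metric form a subgroup. -/
def isometrySubgroup (m : SmoothMetric I M) : Subgroup (Diff I M) where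
  carrier := {g | PreservesMetric m g}
  mul_mem' := PreservesMetric.mul
  one_mem' := fun x v w => by
    change m.inner x (mfderiv I I (1 : Diff I M) x v) (mfderiv I I (1 : Diff I M) x w) = _
    rw [Diff.mfderiv_one, Diff.mfderiv_one]
  inv_mem' := PreservesMetric.inv

theorem PreservesMetric.derivNorm_le_one {m : SmoothMetric I M} {g : Diff I M}
    (h : PreservesMetric m g) : derivNorm m g ≤ ENNReal.ofReal 1 :=
  (derivNorm_le_iff zero_le_one).2 ⟨h.derivBound, h.inv.derivBound⟩

/-- Isometries of one metric have uniformly bounded derivatives in any other metric. -/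
theorem exists_derivNorm_le_of_preservesMetric [CompactSpace M] (m m' : SmoothMetric I M) :
    ∃ C : ℝ, ∀ g : Diff I M, PreservesMetric m' g → derivNorm m g ≤ ENNReal.ofReal C := by
  obtain ⟨C, hC, h⟩ := m.exists_inner_le m'
  obtain ⟨C', hC', h'⟩ := m'.exists_inner_le m
  have key : ∀ g : Diff I M, PreservesMetric m' g → DerivBound m g (Real.sqrt (C * C')) := by
    intro g hg x v
    rw [Real.sq_sqrt (by positivity), mul_assoc]
    refine (h _ _).trans (mul_le_mul_of_nonneg_left ?_ hC.le)
    rw [hg]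
    exact h' x v
  exact ⟨Real.sqrt (C * C'), fun g hg =>
    (derivNorm_le_iff (Real.sqrt_nonneg _)).2 ⟨key g hg, key _ hg.inv⟩⟩

end Metrics

/-! ### Metrics pulled back from a Euclidean space by an immersion -/

section Pullback

open Filter Topology

variable {E : Type*} [NormedAddCommGroup E] [NormedSpace ℝ E]
  {H : Type*} [TopologicalSpace H] {I : ModelWithCorners ℝ E H}
  {M : Type*} [TopologicalSpace M] [ChartedSpace H M] [IsManifold I ∞ M] [IsManifold I 1 M]
  {F : Type*} [NormedAddCommGroup F] [InnerProductSpace ℝ F]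

/-- The pullback of the inner product under a linear map. -/
def pullbackInner (D : E →L[ℝ] F) : E →L[ℝ] E →L[ℝ] ℝ := (innerSL ℝ).bilinearComp D D

theorem pullbackInner_apply (D : E →L[ℝ] F) (v w : E) :
    pullbackInner D v w = inner ℝ (D v) (D w) := rfl

theorem contDiff_pullbackInner [FiniteDimensional ℝ E] :
    ContDiff ℝ ∞ (pullbackInner : (E →L[ℝ] F) → _) := by
  refine contDiff_clm_apply_iff.2 fun v => contDiff_clm_apply_iff.2 fun w => ?_
  simp only [pullbackInner_apply]
  exact ContDiff.inner ℝ (contDiff_id.clm_apply contDiff_const)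
    (contDiff_id.clm_apply contDiff_const)

/-- The differential of a map to a vector space, as a map between normed spaces. -/
def flatDeriv (I : ModelWithCorners ℝ E H) (j : M → F) (x : M) : E →L[ℝ] F :=
  mfderiv I 𝓘(ℝ, F) j x

/-- The pullback of the inner product of `F` under a map `j : M → F`. -/
def pullbackForm (I : ModelWithCorners ℝ E H) (j : M → F) (x : M) :
    TangentSpace I x →L[ℝ] TangentSpace I x →L[ℝ] ℝ :=
  (pullbackInner (flatDeriv I j x) : E →L[ℝ] E →L[ℝ] ℝ)

theorem pullbackForm_apply (j : M → F) (x : M) (v w : TangentSpace I x) :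
    pullbackForm I j x v w =
      inner ℝ (flatDeriv I j x v) (flatDeriv I j x w) :=
  rfl

theorem inTangentCoordinates_apply_of_vectorSpace (j : M → F) {x₀ x : M}
    (hx : x ∈ (trivializationAt E (fun x : M => TangentSpace I x) x₀).baseSet) (v : E) :
    inTangentCoordinates I 𝓘(ℝ, F) id j (mfderiv I 𝓘(ℝ, F) j) x₀ x v =
      flatDeriv I j x
        ((trivializationAt E (fun x : M => TangentSpace I x) x₀).symm x v) := by
  simp only [inTangentCoordinates, ContinuousLinearMap.inCoordinates]
  simp only [TangentBundle.continuousLinearMapAt_model_space]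
  rw [← Trivialization.symmL_apply _ hx (R := ℝ)]
  rfl

/-- In the trivialization at x₀ the form is `pullbackInner` of the coordinate expression of the
differential of j: a smooth map composed with a smooth one. -/
theorem contMDiff_pullbackForm [FiniteDimensional ℝ E] {j : M → F}
    (hj : ContMDiff I 𝓘(ℝ, F) ∞ j) :
    ContMDiff I (I.prod 𝓘(ℝ, E →L[ℝ] E →L[ℝ] ℝ)) ∞
      (fun x => TotalSpace.mk' (E →L[ℝ] E →L[ℝ] ℝ)
        (E := fun x : M => TangentSpace I x →L[ℝ] TangentSpace I x →L[ℝ] ℝ) x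
        (pullbackForm I j x)) := by
  intro x₀
  rw [contMDiffAt_hom_bundle]
  refine ⟨contMDiffAt_id, ?_⟩
  have h1 : ContMDiffAt I 𝓘(ℝ, E →L[ℝ] F) ∞
      (inTangentCoordinates I 𝓘(ℝ, F) id j (mfderiv I 𝓘(ℝ, F) j) x₀) x₀ :=
    (hj x₀).mfderiv_const (by simp)
  have h2 := (contDiff_pullbackInner (E := E) (F := F)).contMDiff.contMDiffAt.comp x₀ h1
  refine h2.congr_of_eventuallyEq ?_
  have hmem := (trivializationAt E (fun x : M => TangentSpace I x) x₀).open_baseSet.mem_nhds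
    (FiberBundle.mem_baseSet_trivializationAt' x₀)
  filter_upwards [hmem] with x hx
  ext v w
  rw [inCoordinates_apply_eq₂ hx hx (Set.mem_univ _)]
  simp only [Function.comp_apply, pullbackInner_apply]
  rw [inTangentCoordinates_apply_of_vectorSpace j hx, inTangentCoordinates_apply_of_vectorSpace j hx]
  simp
  rfl

/-- The pullback of the inner product of `F` under an immersion `j : M → F`. -/
def pullbackMetric [FiniteDimensional ℝ E] (j : M → F) (hj : ContMDiff I 𝓘(ℝ, F) ∞ j)
    (hinj : ∀ x, Function.Injective (flatDeriv I j x)) : SmoothMetric I M where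
  inner := pullbackForm I j
  symm x v w := real_inner_comm _ _
  pos x v hv := by
    rw [pullbackForm_apply, real_inner_self_eq_norm_sq]
    have : flatDeriv I j x v ≠ 0 := fun h =>
      hv (hinj x (h.trans (map_zero (flatDeriv I j x)).symm))
    positivity
  isVonNBounded x := by
    -- An injective linear map on a finite-dimensional space is bounded below, so the unit ball of
    -- the form lies in a norm ball.
    obtain ⟨K, -, hK⟩ := LinearMap.exists_antilipschitzWith
      ((flatDeriv I j x : E →L[ℝ] F) : E →ₗ[ℝ] F) (LinearMap.ker_eq_bot.2 (hinj x))
    have h : Bornology.IsVonNBounded ℝ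
        {v : E | ‖flatDeriv I j x v‖ ^ 2 < 1} := by
      refine (NormedSpace.isVonNBounded_closedBall ℝ E (K : ℝ)).subset fun v hv => ?_
      rw [mem_closedBall_zero_iff]
      have h1 : ‖flatDeriv I j x v‖ ≤ 1 :=
        (sq_le_one_iff₀ (norm_nonneg _)).1 (le_of_lt hv)
      exact (hK.le_mul_norm (map_zero _) v).trans
        (mul_le_of_le_one_right K.coe_nonneg h1)
    simp only [← real_inner_self_eq_norm_sq] at h
    exact h
  contMDiff := contMDiff_pullbackForm hj

theorem pullbackMetric_inner [FiniteDimensional ℝ E] {j : M → F} (hj : ContMDiff I 𝓘(ℝ, F) ∞ j)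
    (hinj : ∀ x, Function.Injective (flatDeriv I j x)) (x : M)
    (v w : TangentSpace I x) : (pullbackMetric j hj hinj).inner x v w =
      inner ℝ (flatDeriv I j x v) (flatDeriv I j x w) :=
  rfl

/-- A diffeomorphism that becomes a linear isometry after the immersion `j` preserves the pullback
metric. -/
theorem preservesMetric_pullbackMetric [FiniteDimensional ℝ E] {j : M → F}
    (hj : ContMDiff I 𝓘(ℝ, F) ∞ j)
    (hinj : ∀ x, Function.Injective (flatDeriv I j x)) (g : Diff I M)
    (R : F →ₗᵢ[ℝ] F) (h : ∀ x, j (g x) = R (j x)) :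
    PreservesMetric (pullbackMetric j hj hinj) g := by
  intro x v w
  have h1 : mfderiv I 𝓘(ℝ, F) (j ∘ g) x =
      (mfderiv I 𝓘(ℝ, F) j (g x)).comp (mfderiv I I g x) :=
    mfderiv_comp x (hj.mdifferentiable (by simp) _) (g.mdifferentiable (by simp) _)
  have hR : HasMFDerivAt 𝓘(ℝ, F) 𝓘(ℝ, F) R (j x) R.toContinuousLinearMap :=
    R.toContinuousLinearMap.hasFDerivAt.hasMFDerivAt
  have h2 : mfderiv I 𝓘(ℝ, F) (R ∘ j) x =
      (mfderiv 𝓘(ℝ, F) 𝓘(ℝ, F) R (j x)).comp (mfderiv I 𝓘(ℝ, F) j x) :=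
    mfderiv_comp x hR.mdifferentiableAt (hj.mdifferentiable (by simp) _)
  rw [hR.mfderiv] at h2
  have h3 : j ∘ g = R ∘ j := funext h
  rw [h3] at h1
  have h4 : ∀ v : TangentSpace I x, flatDeriv I j (g x) (mfderiv I I g x v) =
      R (flatDeriv I j x v) := fun v =>
    congrArg (fun L : E →L[ℝ] F => L v) (h1.symm.trans h2)
  rw [pullbackMetric_inner, pullbackMetric_inner, h4, h4, R.inner_map_map]

end Pullback

/-! ### The action of `SU(2)` on `ℝ⁴` -/

section Representation

/-- The inverse of `toC2`. -/
def ofC2 (z : Fin 2 → ℂ) : EuclideanSpace ℝ (Fin (3 + 1)) :=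
  !₂[(z 0).re, (z 0).im, (z 1).re, (z 1).im]

theorem toC2_ofC2 (z : Fin 2 → ℂ) : toC2 (ofC2 z) = z := by
  ext i
  fin_cases i <;> simp [toC2, ofC2]

theorem ofC2_toC2 (v : EuclideanSpace ℝ (Fin (3 + 1))) : ofC2 (toC2 v) = v := by
  ext i
  fin_cases i <;> simp [toC2, ofC2]

theorem toC2_injective : Function.Injective toC2 :=
  Function.LeftInverse.injective ofC2_toC2

theorem toC2_add (v w : EuclideanSpace ℝ (Fin (3 + 1))) : toC2 (v + w) = toC2 v + toC2 w := by
  ext i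
  fin_cases i <;> apply Complex.ext <;> simp [toC2]

theorem toC2_smul (c : ℝ) (v : EuclideanSpace ℝ (Fin (3 + 1))) :
    toC2 (c • v) = (c : ℂ) • toC2 v := by
  ext i
  fin_cases i <;> apply Complex.ext <;> simp [toC2]

theorem norm_sq_eq_dotProduct_toC2 (v : EuclideanSpace ℝ (Fin (3 + 1))) :
    ((‖v‖ ^ 2 : ℝ) : ℂ) = star (toC2 v) ⬝ᵥ toC2 v := by
  rw [EuclideanSpace.norm_sq_eq]
  apply Complex.ext <;>
    simp [Fin.sum_univ_four, toC2, dotProduct, Fin.sum_univ_two, -Complex.ofReal_pow] <;> ring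

/-- The action of a matrix in `SU(2)` on `ℝ⁴ = ℂ²`. -/
def suAct (a : Matrix.specialUnitaryGroup (Fin 2) ℂ) (v : EuclideanSpace ℝ (Fin (3 + 1))) :
    EuclideanSpace ℝ (Fin (3 + 1)) := ofC2 ((a : Matrix (Fin 2) (Fin 2) ℂ) *ᵥ toC2 v)

theorem toC2_suAct (a : Matrix.specialUnitaryGroup (Fin 2) ℂ)
    (v : EuclideanSpace ℝ (Fin (3 + 1))) :
    toC2 (suAct a v) = (a : Matrix (Fin 2) (Fin 2) ℂ) *ᵥ toC2 v := toC2_ofC2 _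

theorem suAct_mul (a b : Matrix.specialUnitaryGroup (Fin 2) ℂ)
    (v : EuclideanSpace ℝ (Fin (3 + 1))) : suAct (a * b) v = suAct a (suAct b v) := by
  apply toC2_injective
  rw [toC2_suAct, toC2_suAct, toC2_suAct, Matrix.mulVec_mulVec, Submonoid.coe_mul]

theorem suAct_one (v : EuclideanSpace ℝ (Fin (3 + 1))) : suAct 1 v = v := by
  apply toC2_injective
  rw [toC2_suAct, Submonoid.coe_one, Matrix.one_mulVec]

theorem norm_suAct (a : Matrix.specialUnitaryGroup (Fin 2) ℂ)
    (v : EuclideanSpace ℝ (Fin (3 + 1))) : ‖suAct a v‖ = ‖v‖ := by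
  have h : ((‖suAct a v‖ ^ 2 : ℝ) : ℂ) = ((‖v‖ ^ 2 : ℝ) : ℂ) := by
    rw [norm_sq_eq_dotProduct_toC2, norm_sq_eq_dotProduct_toC2, toC2_suAct, Matrix.star_mulVec,
      Matrix.dotProduct_mulVec, Matrix.vecMul_vecMul, ← Matrix.star_eq_conjTranspose,
      Matrix.mem_unitaryGroup_iff'.1 (Matrix.mem_specialUnitaryGroup_iff.1 a.2).1,
      Matrix.vecMul_one]
  exact (sq_eq_sq₀ (norm_nonneg _) (norm_nonneg _)).1 (Complex.ofReal_injective h)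

/-- The action of `SU(2)` on `ℝ⁴` by linear isometries. -/
def suRep : Matrix.specialUnitaryGroup (Fin 2) ℂ →*
    (EuclideanSpace ℝ (Fin (3 + 1)) ≃ₗᵢ[ℝ] EuclideanSpace ℝ (Fin (3 + 1))) where
  toFun a :=
    { toFun := suAct a
      invFun := suAct a⁻¹
      left_inv := fun v => by rw [← suAct_mul, inv_mul_cancel, suAct_one]
      right_inv := fun v => by rw [← suAct_mul, mul_inv_cancel, suAct_one]
      map_add' := fun v w => toC2_injective <| by
        rw [toC2_suAct, toC2_add, Matrix.mulVec_add, toC2_add, toC2_suAct, toC2_suAct]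
      map_smul' := fun c v => toC2_injective <| by
        rw [toC2_suAct, toC2_smul, Matrix.mulVec_smul, RingHom.id_apply, toC2_smul, toC2_suAct]
      norm_map' := norm_suAct a }
  map_one' := LinearIsometryEquiv.ext suAct_one
  map_mul' a b := LinearIsometryEquiv.ext (suAct_mul a b)

theorem suRep_apply (a : Matrix.specialUnitaryGroup (Fin 2) ℂ)
    (v : EuclideanSpace ℝ (Fin (3 + 1))) : suRep a v = suAct a v := rfl

theorem eq_one_of_suRep_apply_eq {a : Matrix.specialUnitaryGroup (Fin 2) ℂ}
    {v : EuclideanSpace ℝ (Fin (3 + 1))} (hv : v ≠ 0) (h : suRep a v = v) : a = 1 := by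
  have h0 : toC2 v ≠ 0 := fun h0 => hv (toC2_injective (h0.trans (by
    have := toC2_smul 0 0
    simpa using this.symm)))
  refine eq_one_of_mulVec_eq h0 ?_
  rw [← toC2_suAct, ← suRep_apply, h]

/-- Every linear map factors through `a - 1` for `a ≠ 1` in `SU(2)`. -/
theorem exists_comp_suRep_sub {a : Matrix.specialUnitaryGroup (Fin 2) ℂ} (ha : a ≠ 1)
    (Q : EuclideanSpace ℝ (Fin (3 + 1)) →L[ℝ] EuclideanSpace ℝ (Fin (3 + 1))) :
    ∃ C : EuclideanSpace ℝ (Fin (3 + 1)) →L[ℝ] EuclideanSpace ℝ (Fin (3 + 1)),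
      ∀ v, C (suRep a v) - C v = Q v := by
  let D : EuclideanSpace ℝ (Fin (3 + 1)) →ₗ[ℝ] EuclideanSpace ℝ (Fin (3 + 1)) :=
    (suRep a).toLinearEquiv.toLinearMap - LinearMap.id
  have hD : Function.Injective D := by
    rw [← LinearMap.ker_eq_bot, LinearMap.ker_eq_bot']
    intro v hv
    by_contra hne
    exact ha (eq_one_of_suRep_apply_eq hne (sub_eq_zero.1 hv))
  let e := LinearEquiv.ofInjectiveEndo D hD
  refine ⟨LinearMap.toContinuousLinearMap (Q.toLinearMap ∘ₗ e.symm.toLinearMap), fun v => ?_⟩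
  rw [← map_sub]
  have h : suRep a v - v = e v := rfl
  rw [h]
  simp

/-- Every point of the unit sphere is moved into the half-space `{x > 0}` by a generator. -/
theorem exists_suRep_suGen_apply_zero_ge {v : EuclideanSpace ℝ (Fin (3 + 1))} (hv : ‖v‖ = 1) :
    ∃ i, 1 / 26 ≤ suRep (suGen i) v 0 := by
  have hsq : v 0 ^ 2 + v 1 ^ 2 + v 2 ^ 2 + v 3 ^ 2 = 1 := by
    have h := EuclideanSpace.norm_sq_eq v
    rw [hv, Fin.sum_univ_four] at h
    simpa using h.symm
  have hval : ∀ i, suRep (suGen i) v 0 =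
      (![12 * v 0 - 4 * v 1 + 3 * v 2, 12 * v 0 + 4 * v 1 + 3 * v 2, -12 * v 0 + 5 * v 2,
        3 * v 0 - 4 * v 2 + 12 * v 3, -3 * v 0 - 4 * v 2 - 12 * v 3] i) / 13 := by
    intro i
    rw [suRep_apply, suAct]
    fin_cases i <;>
      simp [ofC2, toC2, suGen, gaussGen, Matrix.mulVec, dotProduct, Fin.sum_univ_two,
        GaussianInt.toComplex_def] <;> ring
  -- The five covectors in `hval`, with positive weights 1, 1, 2, 2, 2, sum to zero and span ℝ⁴, so
  -- upper bounds on all five confine v to a small box. The bound 1/26 = (1/2)/13 makes this box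
  -- miss the unit sphere.
  by_contra! h
  have h0 := h 0
  have h1 := h 1
  have h2 := h 2
  have h3 := h 3
  have h4 := h 4
  rw [hval] at h0 h1 h2 h3 h4
  simp at h0 h1 h2 h3 h4
  have z1 : v 2 < 1 / 8 := by linarith
  have z2 : -(1 / 8) < v 2 := by linarith
  have x1 : v 0 < 1 / 8 := by linarith
  have x2 : -(1 / 8) < v 0 := by linarith
  have y1 : v 1 < 1 / 2 := by linarith
  have y2 : -(1 / 2) < v 1 := by linarith
  have u1 : v 3 < 1 / 8 := by linarith
  have u2 : -(1 / 8) < v 3 := by linarith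
  have hx : v 0 ^ 2 < (1 / 8) ^ 2 := sq_lt_sq' x2 x1
  have hy : v 1 ^ 2 < (1 / 2) ^ 2 := sq_lt_sq' y2 y1
  have hz : v 2 ^ 2 < (1 / 8) ^ 2 := sq_lt_sq' z2 z1
  have hu : v 3 ^ 2 < (1 / 8) ^ 2 := sq_lt_sq' u2 u1
  norm_num at hx hy hz hu
  linarith

end Representation

/-! ### Skew products -/

section SkewProduct

/-- The isometry of the sphere induced by a linear isometry. -/
def sphereIsometry (R : EuclideanSpace ℝ (Fin (3 + 1)) ≃ₗᵢ[ℝ] EuclideanSpace ℝ (Fin (3 + 1)))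
    (v : S3) : S3 := ⟨R v, by simp⟩

/-- The skew product `(v, s) ↦ (R v, F(Q v) s)`. -/
def skewMap (R : EuclideanSpace ℝ (Fin (3 + 1)) ≃ₗᵢ[ℝ] EuclideanSpace ℝ (Fin (3 + 1)))
    (Q : EuclideanSpace ℝ (Fin (3 + 1)) →L[ℝ] EuclideanSpace ℝ (Fin (3 + 1)))
    (x : S3 × Circle) : S3 × Circle :=
  (sphereIsometry R x.1, flowProduct quarterFlow (Q x.1) x.2)

/-- Since `F` is a homomorphism, the cocycle of a composition is a sum and stays linear; this is
what reduces the coboundary equation to linear algebra. -/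
theorem skewMap_skewMap
    (R R' : EuclideanSpace ℝ (Fin (3 + 1)) ≃ₗᵢ[ℝ] EuclideanSpace ℝ (Fin (3 + 1)))
    (Q Q' : EuclideanSpace ℝ (Fin (3 + 1)) →L[ℝ] EuclideanSpace ℝ (Fin (3 + 1)))
    (x : S3 × Circle) : skewMap R' Q' (skewMap R Q x) =
      skewMap (R' * R) (Q + Q' ∘L R.toContinuousLinearEquiv.toContinuousLinearMap) x := by
  refine Prod.ext rfl ?_
  change flowProduct quarterFlow (Q' (R x.1)) (flowProduct quarterFlow (Q x.1) x.2) =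
    flowProduct quarterFlow (Q x.1 + Q' (R x.1)) x.2
  rw [add_comm (Q _) (Q' _), flowProduct_add, Diff.mul_apply]

theorem skewMap_one_zero (x : S3 × Circle) : skewMap 1 0 x = x := by
  refine Prod.ext rfl ?_
  change flowProduct quarterFlow 0 x.2 = x.2
  rw [flowProduct_zero, Diff.one_apply]

theorem contMDiff_coe_S3 :
    ContMDiff (𝓡 3) 𝓘(ℝ, EuclideanSpace ℝ (Fin (3 + 1))) ∞
      fun v : S3 => (v : EuclideanSpace ℝ (Fin (3 + 1))) :=
  have := Fact.mk (@finrank_euclideanSpace_fin ℝ _ (3 + 1))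
  contMDiff_coe_sphere

theorem contMDiff_sphereIsometry
    (R : EuclideanSpace ℝ (Fin (3 + 1)) ≃ₗᵢ[ℝ] EuclideanSpace ℝ (Fin (3 + 1))) :
    ContMDiff (𝓡 3) (𝓡 3) ∞ (sphereIsometry R) :=
  have := Fact.mk (@finrank_euclideanSpace_fin ℝ _ (3 + 1))
  ContMDiff.codRestrict_sphere (f := fun v : S3 => R (v : EuclideanSpace ℝ (Fin (3 + 1))))
    (R.contDiff.contMDiff.comp contMDiff_coe_S3) fun v => by simp

theorem contMDiff_skewMap
    (R : EuclideanSpace ℝ (Fin (3 + 1)) ≃ₗᵢ[ℝ] EuclideanSpace ℝ (Fin (3 + 1)))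
    (Q : EuclideanSpace ℝ (Fin (3 + 1)) →L[ℝ] EuclideanSpace ℝ (Fin (3 + 1))) :
    ContMDiff modelM modelM ∞ (skewMap R Q) := by
  have h1 : ContMDiff modelM (𝓡 3) ∞ fun x : S3 × Circle => sphereIsometry R x.1 :=
    (contMDiff_sphereIsometry R).comp contMDiff_fst
  have hQ : ContMDiff modelM 𝓘(ℝ, EuclideanSpace ℝ (Fin (3 + 1))) ∞
      fun x : S3 × Circle => Q x.1 :=
    Q.contDiff.contMDiff.comp (contMDiff_coe_S3.comp contMDiff_fst)
  have h2 : ContMDiff modelM (𝓡 1) ∞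
      fun x : S3 × Circle => flowProduct quarterFlow (Q x.1) x.2 :=
    ContMDiff.comp (I' := 𝓘(ℝ, EuclideanSpace ℝ (Fin (3 + 1))).prod (𝓡 1))
      (g := fun q : EuclideanSpace ℝ (Fin (3 + 1)) × Circle => flowProduct quarterFlow q.1 q.2)
      (f := fun x : S3 × Circle => (Q x.1, x.2)) contMDiff_flowProduct (hQ.prodMk contMDiff_snd)
  exact h1.prodMk h2

/-- The skew product `(v, s) ↦ (R v, F(Q v) s)` as a diffeomorphism. -/
def skewDiffeo (R : EuclideanSpace ℝ (Fin (3 + 1)) ≃ₗᵢ[ℝ] EuclideanSpace ℝ (Fin (3 + 1)))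
    (Q : EuclideanSpace ℝ (Fin (3 + 1)) →L[ℝ] EuclideanSpace ℝ (Fin (3 + 1))) :
    Diff modelM (S3 × Circle) where
  toFun := skewMap R Q
  invFun := skewMap R⁻¹ (-(Q ∘L (R⁻¹).toContinuousLinearEquiv.toContinuousLinearMap))
  left_inv x := by
    rw [skewMap_skewMap, inv_mul_cancel]
    convert! skewMap_one_zero x using 2
    ext v : 1
    change Q v + -Q (R.symm (R v)) = 0
    rw [R.symm_apply_apply, add_neg_cancel]
  right_inv x := by
    rw [skewMap_skewMap, mul_inv_cancel]
    convert! skewMap_one_zero x using 2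
    ext v : 1
    simp
  contMDiff_toFun := contMDiff_skewMap R Q
  contMDiff_invFun := contMDiff_skewMap _ _

theorem skewDiffeo_mul
    (R R' : EuclideanSpace ℝ (Fin (3 + 1)) ≃ₗᵢ[ℝ] EuclideanSpace ℝ (Fin (3 + 1)))
    (Q Q' : EuclideanSpace ℝ (Fin (3 + 1)) →L[ℝ] EuclideanSpace ℝ (Fin (3 + 1))) :
    skewDiffeo R' Q' * skewDiffeo R Q =
      skewDiffeo (R' * R) (Q + Q' ∘L R.toContinuousLinearEquiv.toContinuousLinearMap) :=
  Diffeomorph.ext fun x => skewMap_skewMap R R' Q Q' x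

theorem skewDiffeo_one_zero : skewDiffeo 1 0 = 1 := Diffeomorph.ext skewMap_one_zero

theorem skewDiffeo_inv
    (R : EuclideanSpace ℝ (Fin (3 + 1)) ≃ₗᵢ[ℝ] EuclideanSpace ℝ (Fin (3 + 1)))
    (Q : EuclideanSpace ℝ (Fin (3 + 1)) →L[ℝ] EuclideanSpace ℝ (Fin (3 + 1))) :
    (skewDiffeo R Q)⁻¹ =
      skewDiffeo R⁻¹ (-(Q ∘L (R⁻¹).toContinuousLinearEquiv.toContinuousLinearMap)) :=
  Diffeomorph.ext fun _ => rfl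

/-! ### The product metric and its conjugates -/

/-- The embedding of `S³ × S¹` in `ℝ⁴ × ℂ`. -/
def ambient (x : S3 × Circle) : WithLp 2 (EuclideanSpace ℝ (Fin (3 + 1)) × ℂ) :=
  (WithLp.prodContinuousLinearEquiv 2 ℝ (EuclideanSpace ℝ (Fin (3 + 1))) ℂ).symm
    ((x.1 : EuclideanSpace ℝ (Fin (3 + 1))), (x.2 : ℂ))

theorem contMDiff_ambient :
    ContMDiff modelM 𝓘(ℝ, WithLp 2 (EuclideanSpace ℝ (Fin (3 + 1)) × ℂ)) ∞ ambient :=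
  (ContinuousLinearEquiv.contDiff _).contMDiff.comp
    ((contMDiff_coe_S3.comp contMDiff_fst).prodMk_space (contMDiff_circle_coe.comp contMDiff_snd))

theorem mfderiv_coe_S3_injective (v : S3) : Function.Injective
    (flatDeriv (𝓡 3) (fun v : S3 => (v : EuclideanSpace ℝ (Fin (3 + 1)))) v) := by
  have := Fact.mk (@finrank_euclideanSpace_fin ℝ _ (3 + 1))
  exact injective_mvfderiv_subtypeVal_sphere (n := 3) v

theorem mfderiv_coe_circle_injective (s : Circle) : Function.Injective
    (flatDeriv (𝓡 1) (fun z : Circle => (z : ℂ)) s) := by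
  have := finrank_real_complex_fact'
  exact injective_mvfderiv_subtypeVal_sphere (E := ℂ) (n := 1) s

/-- Projecting the embedding to ℝ⁴ and to ℂ reduces the claim to the immersions of the two spheres.
-/
theorem flatDeriv_ambient_injective (x : S3 × Circle) :
    Function.Injective (flatDeriv modelM ambient x) := by
  rw [injective_iff_map_eq_zero]
  rintro ⟨v, ξ⟩ h
  have hx : MDifferentiableAt modelM 𝓘(ℝ, WithLp 2 (EuclideanSpace ℝ (Fin (3 + 1)) × ℂ))
      ambient x := contMDiff_ambient.mdifferentiable (by simp) x
  have key : ∀ {G : Type} [NormedAddCommGroup G] [InnerProductSpace ℝ G]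
      (L : WithLp 2 (EuclideanSpace ℝ (Fin (3 + 1)) × ℂ) →L[ℝ] G),
      flatDeriv modelM (L ∘ ambient) x (v, ξ) = 0 := by
    intro G _ _ L
    have hL : HasMFDerivAt 𝓘(ℝ, WithLp 2 (EuclideanSpace ℝ (Fin (3 + 1)) × ℂ)) 𝓘(ℝ, G) L
        (ambient x) L := L.hasFDerivAt.hasMFDerivAt
    have h1 := (hL.comp x hx.hasMFDerivAt).mfderiv
    have h2 : flatDeriv modelM (L ∘ ambient) x = L ∘L flatDeriv modelM ambient x := h1
    rw [h2, ContinuousLinearMap.comp_apply, h, map_zero]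
  have hv : v = 0 := by
    have h1 := key (WithLp.fstL 2 ℝ (EuclideanSpace ℝ (Fin (3 + 1))) ℂ)
    have h2 : flatDeriv modelM (WithLp.fstL 2 ℝ (EuclideanSpace ℝ (Fin (3 + 1))) ℂ ∘ ambient) x =
        flatDeriv (𝓡 3) (fun v : S3 => (v : EuclideanSpace ℝ (Fin (3 + 1)))) x.1 ∘L
          ContinuousLinearMap.fst ℝ _ _ :=
      (((contMDiff_coe_S3.mdifferentiable (by simp) x.1).hasMFDerivAt).comp x
        (hasMFDerivAt_fst x)).mfderiv
    rw [h2] at h1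
    exact mfderiv_coe_S3_injective x.1 (h1.trans (map_zero _).symm)
  have hξ : ξ = 0 := by
    have h1 := key (WithLp.sndL 2 ℝ (EuclideanSpace ℝ (Fin (3 + 1))) ℂ)
    have h2 : flatDeriv modelM (WithLp.sndL 2 ℝ (EuclideanSpace ℝ (Fin (3 + 1))) ℂ ∘ ambient) x =
        flatDeriv (𝓡 1) (fun z : Circle => (z : ℂ)) x.2 ∘L
          ContinuousLinearMap.snd ℝ _ _ :=
      (((contMDiff_circle_coe.mdifferentiable (by simp) x.2).hasMFDerivAt).comp x
        (hasMFDerivAt_snd x)).mfderiv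
    rw [h2] at h1
    exact mfderiv_coe_circle_injective x.2 (h1.trans (map_zero _).symm)
  rw [hv, hξ]
  rfl

theorem contMDiff_ambient_comp (h : Diff modelM (S3 × Circle)) :
    ContMDiff modelM 𝓘(ℝ, WithLp 2 (EuclideanSpace ℝ (Fin (3 + 1)) × ℂ)) ∞ (ambient ∘ h) :=
  contMDiff_ambient.comp h.contMDiff

theorem flatDeriv_ambient_comp_injective (h : Diff modelM (S3 × Circle)) (x : S3 × Circle) :
    Function.Injective (flatDeriv modelM (ambient ∘ h) x) := by
  have h1 : mfderiv modelM 𝓘(ℝ, WithLp 2 (EuclideanSpace ℝ (Fin (3 + 1)) × ℂ)) (ambient ∘ h) x =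
      (mfderiv modelM 𝓘(ℝ, WithLp 2 (EuclideanSpace ℝ (Fin (3 + 1)) × ℂ)) ambient (h x)).comp
        (mfderiv modelM modelM h x) :=
    mfderiv_comp x (contMDiff_ambient.mdifferentiable (by simp) _)
      (h.mdifferentiable (by simp) _)
  have h2 : Function.Injective (mfderiv modelM modelM h x) := by
    have key : ∀ g : Diff modelM (S3 × Circle), g = 1 →
        ∀ v : TangentSpace modelM x, mfderiv modelM modelM g x v = v := by
      rintro g rfl v
      exact Diff.mfderiv_one x v
    have hl : ∀ v : TangentSpace modelM x, mfderiv modelM modelM (h⁻¹ : Diff modelM (S3 × Circle))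
        (h x) (mfderiv modelM modelM h x v) = v := fun v =>
      (Diff.mfderiv_mul h⁻¹ h x v).symm.trans (key _ (inv_mul_cancel h) v)
    exact fun v w hvw => (hl v).symm.trans ((congrArg (mfderiv modelM modelM
      (h⁻¹ : Diff modelM (S3 × Circle)) (h x)) hvw).trans (hl w))
  have h3 := (flatDeriv_ambient_injective (h x)).comp h2
  intro v w hvw
  exact h3 ((congrArg (fun L => L v) h1).symm.trans (hvw.trans (congrArg (fun L => L w) h1)))

/-- The pullback of the metric of `S³ × S¹` under a diffeomorphism. -/
def ambientMetric (h : Diff modelM (S3 × Circle)) : SmoothMetric modelM (S3 × Circle) :=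
  pullbackMetric (ambient ∘ h) (contMDiff_ambient_comp h) (flatDeriv_ambient_comp_injective h)

/-- A skew product whose cocycle is a coboundary preserves a metric. -/
theorem exists_preservesMetric_skewDiffeo
    {R : EuclideanSpace ℝ (Fin (3 + 1)) ≃ₗᵢ[ℝ] EuclideanSpace ℝ (Fin (3 + 1))}
    {Q C : EuclideanSpace ℝ (Fin (3 + 1)) →L[ℝ] EuclideanSpace ℝ (Fin (3 + 1))}
    (hC : ∀ v, C (R v) - C v = Q v) :
    ∃ m : SmoothMetric modelM (S3 × Circle), PreservesMetric m (skewDiffeo R Q) := by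
  refine ⟨ambientMetric (skewDiffeo 1 (-C)), preservesMetric_pullbackMetric _ _ _
    (R.toLinearIsometry.withLpProdMap 2 LinearIsometry.id) fun x => ?_⟩
  -- Since Q - C R = -C, the conjugating map turns the skew product into R times the identity on the
  -- circle.
  have h1 : skewMap 1 (-C) (skewMap R Q x) = (sphereIsometry R x.1, (skewMap 1 (-C) x).2) := by
    rw [skewMap_skewMap]
    refine Prod.ext rfl ?_
    change flowProduct quarterFlow (Q x.1 + -C (R x.1)) x.2 = flowProduct quarterFlow (-C x.1) x.2
    rw [← hC]
    congr 2
    abel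
  change ambient (skewMap 1 (-C) (skewMap R Q x)) = _
  rw [h1]
  rfl

end SkewProduct

/-! ### Word length -/

section WordLength

variable {G : Type*} [Group G] {S : Set G}

theorem exists_list_of_mem_subgroup_closure {g : G} (hg : g ∈ Subgroup.closure S) :
    ∃ l : List G, (∀ x ∈ l, x ∈ S ∨ x⁻¹ ∈ S) ∧ l.prod = g := by
  rw [← Subgroup.mem_toSubmonoid, Subgroup.closure_toSubmonoid] at hg
  obtain ⟨l, hl, hg⟩ := Submonoid.exists_list_of_mem_closure hg
  exact ⟨l, fun x hx => by simpa using hl x hx, hg⟩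

theorem exists_list_length_eq_wordLength {g : G} (hg : g ∈ Subgroup.closure S) :
    ∃ l : List G, l.length = wordLength S g ∧ (∀ x ∈ l, x ∈ S ∨ x⁻¹ ∈ S) ∧ l.prod = g := by
  obtain ⟨l, hl, hg⟩ := exists_list_of_mem_subgroup_closure hg
  exact Nat.sInf_mem (s := {n | ∃ l : List G, l.length = n ∧ (∀ x ∈ l, x ∈ S ∨ x⁻¹ ∈ S) ∧
    l.prod = g}) ⟨l.length, l, rfl, hl, hg⟩

theorem wordLength_le {l : List G} (hl : ∀ x ∈ l, x ∈ S ∨ x⁻¹ ∈ S) :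
    wordLength S l.prod ≤ l.length := Nat.sInf_le ⟨l, rfl, hl, rfl⟩

theorem wordLength_one : wordLength S (1 : G) = 0 :=
  Nat.le_zero.1 (wordLength_le (S := S) (l := []) (by simp))

theorem wordLength_mul_le {g h : G} (hg : g ∈ Subgroup.closure S) (hh : h ∈ Subgroup.closure S) :
    wordLength S (g * h) ≤ wordLength S g + wordLength S h := by
  obtain ⟨l, hl, hl', rfl⟩ := exists_list_length_eq_wordLength hg
  obtain ⟨k, hk, hk', rfl⟩ := exists_list_length_eq_wordLength hh
  rw [← hl, ← hk, ← List.prod_append, ← List.length_append]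
  refine wordLength_le fun x hx => ?_
  rcases List.mem_append.1 hx with hx | hx
  exacts [hl' x hx, hk' x hx]

theorem wordLength_inv_le {g : G} (hg : g ∈ Subgroup.closure S) :
    wordLength S g⁻¹ ≤ wordLength S g := by
  obtain ⟨l, hl, hl', rfl⟩ := exists_list_length_eq_wordLength hg
  rw [← hl, List.prod_inv_reverse]
  refine (wordLength_le fun x hx => ?_).trans (by simp)
  obtain ⟨y, hy, rfl⟩ := List.mem_map.1 (List.mem_reverse.1 hx)
  rw [inv_inv]
  exact (hl' y hy).symm

/-- Word lengths with respect to two finite generating sets are comparable. -/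
theorem exists_wordLength_le_mul {T : Set G} (hS : S.Finite)
    (h : Subgroup.closure S ≤ Subgroup.closure T) :
    ∃ N : ℕ, ∀ g ∈ Subgroup.closure S, wordLength T g ≤ N * wordLength S g := by
  obtain ⟨N, hN⟩ := (hS.image (wordLength T)).bddAbove
  have hgen : ∀ x, x ∈ S ∨ x⁻¹ ∈ S → x ∈ Subgroup.closure T ∧ wordLength T x ≤ N := by
    rintro x (hx | hx)
    · exact ⟨h (Subgroup.subset_closure hx), hN ⟨x, hx, rfl⟩⟩
    · have hx' := h (Subgroup.subset_closure hx)
      refine ⟨by simpa using inv_mem hx', ?_⟩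
      have := wordLength_inv_le hx'
      rw [inv_inv] at this
      exact this.trans (hN ⟨_, hx, rfl⟩)
  have hlist : ∀ l : List G, (∀ x ∈ l, x ∈ S ∨ x⁻¹ ∈ S) →
      l.prod ∈ Subgroup.closure T ∧ wordLength T l.prod ≤ N * l.length := by
    intro l
    induction l with
    | nil => exact fun _ => ⟨one_mem _, by simp [wordLength_one]⟩
    | cons x l ih =>
      intro hl
      obtain ⟨h1, h2⟩ := hgen x (hl x List.mem_cons_self)
      obtain ⟨h3, h4⟩ := ih fun y hy => hl y (List.mem_cons_of_mem _ hy)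
      rw [List.prod_cons, List.length_cons]
      refine ⟨mul_mem h1 h3, (wordLength_mul_le h1 h3).trans ?_⟩
      linarith
  refine ⟨N, fun g hg => ?_⟩
  obtain ⟨l, hl, hl', rfl⟩ := exists_list_length_eq_wordLength hg
  rw [← hl]
  exact (hlist l hl').2

/-- In a free group, positive words are geodesic. -/
theorem wordLength_map_prod {ι : Type*} {A : ι → G}
    (hA : Function.Injective (FreeGroup.lift A)) (L : List ι) :
    wordLength (range A) (L.map A).prod = L.length := by
  -- The exponent sum: a product of n generators and inverses has value at most n, while a positive
  -- word attains its length.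
  let d : FreeGroup ι →* Multiplicative ℤ := FreeGroup.lift fun _ => Multiplicative.ofAdd 1
  have hd : ∀ L : List ι, FreeGroup.lift A (L.map FreeGroup.of).prod = (L.map A).prod ∧
      (d (L.map FreeGroup.of).prod).toAdd = L.length := by
    intro L
    induction L with
    | nil => simp
    | cons i L ih =>
      simp only [List.map_cons, List.prod_cons, map_mul, ih.1, FreeGroup.lift_apply_of, toAdd_mul,
        ih.2, List.length_cons, true_and]
      simp [d]
      ring
  have hlift : ∀ l : List G, (∀ x ∈ l, x ∈ range A ∨ x⁻¹ ∈ range A) →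
      ∃ w, FreeGroup.lift A w = l.prod ∧ (d w).toAdd ≤ l.length := by
    intro l
    induction l with
    | nil => exact fun _ => ⟨1, by simp⟩
    | cons x l ih =>
      intro hl
      obtain ⟨w, hw, hw'⟩ := ih fun y hy => hl y (List.mem_cons_of_mem _ hy)
      rcases hl x List.mem_cons_self with ⟨i, hi⟩ | ⟨i, hi⟩
      · refine ⟨FreeGroup.of i * w, by simp [hw, hi], ?_⟩
        simp [d] at hw' ⊢
        linarith
      · refine ⟨(FreeGroup.of i)⁻¹ * w, by simp [hw, hi], ?_⟩
        simp [d] at hw' ⊢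
        linarith
  refine le_antisymm ?_ ?_
  · refine (wordLength_le fun x hx => ?_).trans (List.length_map _).le
    obtain ⟨i, -, rfl⟩ := List.mem_map.1 hx
    exact .inl ⟨i, rfl⟩
  · have hmem : (L.map A).prod ∈ Subgroup.closure (range A) :=
      list_prod_mem fun x hx => by
        obtain ⟨i, -, rfl⟩ := List.mem_map.1 hx
        exact Subgroup.subset_closure ⟨i, rfl⟩
    obtain ⟨l, hl, hl', hprod⟩ := exists_list_length_eq_wordLength hmem
    obtain ⟨w, hw, hw'⟩ := hlift l hl'
    rw [hprod, ← (hd L).1] at hw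
    rw [hA hw, (hd L).2] at hw'
    rw [← hl]
    exact_mod_cast hw'

end WordLength

/-! ### Exponential growth and submultiplicativity -/

section Growth

variable {E : Type*} [NormedAddCommGroup E] [NormedSpace ℝ E]
  {H : Type*} [TopologicalSpace H] {I : ModelWithCorners ℝ E H}
  {M : Type*} [TopologicalSpace M] [ChartedSpace H M] [IsManifold I 1 M]

/-- Exponential growth along one sequence of elements implies exponential growth, for all finite
generating sets. -/
theorem hasExponentialGrowth_of_sequence {m : SmoothMetric I M} {S : Set (Diff I M)}
    (hS : S.Finite) {ε : ℝ} (hε : 0 < ε) {W : ℕ → Diff I M}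
    (hW : ∀ n, W n ∈ Subgroup.closure S ∧ wordLength S (W n) = n ∧
      ENNReal.ofReal (Real.exp (ε * n)) ≤ derivNorm m (W n)) :
    HasExponentialGrowth m (Subgroup.closure S) := by
  refine ⟨(Subgroup.fg_iff _).2 ⟨S, rfl, hS⟩, ?_⟩
  rintro ⟨T, -, hT, hsub⟩
  obtain ⟨N, hN⟩ := exists_wordLength_le_mul hS hT.ge
  have hN0 : (0 : ℝ) ≤ N := N.cast_nonneg
  -- Passing from S to T costs a factor N in length; this rate keeps the assumed bound below
  -- e^(εn/2). The 1 added to N covers N = 0.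
  have hε' : 0 < ε / (2 * (N + 1)) := by positivity
  obtain ⟨C, hC⟩ := hsub _ hε'
  have hCpos : ∀ n : ℕ, Real.exp (ε / 2) ^ n ≤ |C| := by
    intro n
    obtain ⟨h1, h2, h3⟩ := hW n
    have h4 := h3.trans (hC _ h1)
    have h5 : Real.exp (ε * n) ≤
        C * Real.exp (ε / (2 * (N + 1)) * wordLength T (W n)) :=
      (ENNReal.ofReal_le_ofReal_iff'.1 h4).resolve_right (Real.exp_pos _).not_ge
    have h6 : (wordLength T (W n) : ℝ) ≤ (N + 1) * n := by
      have h7 := hN _ h1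
      rw [h2] at h7
      have h8 : (wordLength T (W n) : ℝ) ≤ N * n := by exact_mod_cast h7
      have h9 : (0 : ℝ) ≤ n := n.cast_nonneg
      linarith
    have h7 : ε / (2 * (N + 1)) * wordLength T (W n) ≤ ε / 2 * n :=
      calc _ ≤ ε / (2 * (N + 1)) * ((N + 1) * n) := by gcongr
        _ = ε / 2 * n := by field_simp
    have h8 : Real.exp (ε * n) ≤ |C| * Real.exp (ε / 2 * n) :=
      h5.trans (mul_le_mul (le_abs_self C) (Real.exp_le_exp.2 h7) (Real.exp_pos _).le
        (abs_nonneg C))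
    have h9 : Real.exp (ε * n) = Real.exp (ε / 2 * n) * Real.exp (ε / 2 * n) := by
      rw [← Real.exp_add]
      ring_nf
    rw [h9] at h8
    rw [← Real.exp_nat_mul, mul_comm]
    exact le_of_mul_le_mul_right h8 (Real.exp_pos _)
  obtain ⟨n, hn⟩ := pow_unbounded_of_one_lt |C| (Real.one_lt_exp_iff.2 (half_pos hε))
  exact (hCpos n).not_gt hn

/-- A bound for all positive words of length `n` gives a bound for those of length `n * k`. -/
theorem derivNorm_map_prod_le_pow {ι : Type*} {m : SmoothMetric I M} {A : ι → Diff I M} {n : ℕ}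
    {K : ℝ} (hK : 0 ≤ K)
    (h : ∀ L : List ι, L.length = n → derivNorm m (L.map A).prod ≤ ENNReal.ofReal K) (k : ℕ) :
    ∀ L : List ι, L.length = n * k → derivNorm m (L.map A).prod ≤ ENNReal.ofReal (K ^ k) := by
  induction k with
  | zero =>
    intro L hL
    rw [mul_zero, List.length_eq_zero_iff] at hL
    simpa [hL] using derivNorm_one_le m
  | succ k ih =>
    intro L hL
    rw [← List.take_append_drop n L, List.map_append, List.prod_append, pow_succ']
    refine derivNorm_mul_le hK (pow_nonneg hK k) (h _ ?_) (ih _ ?_)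
    · rw [List.length_take, hL, min_eq_left (Nat.le_mul_of_pos_right n k.succ_pos)]
    · rw [List.length_drop, hL, Nat.mul_succ, Nat.add_sub_cancel]

end Growth

/-! ### The group of skew products -/

section SkewGroup

/-- A point of the sphere. -/
def basePoint : S3 := ⟨EuclideanSpace.single 0 1, by simp⟩

/-- The generators of the group. -/
def skewGen (i : Fin 5) : Diff modelM (S3 × Circle) :=
  skewDiffeo (suRep (suGen i)) (ContinuousLinearMap.id ℝ _)

theorem isSkewProduct_skewGen (i : Fin 5) : IsSkewProduct quarterFlow (suGen i) (skewGen i) :=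
  fun v _ => ⟨toC2_suAct (suGen i) v, rfl⟩

/-- Only the linearity of the cocycle matters, not its value: the coboundary equation is solvable
for every Q. -/
theorem exists_lift_skewGen_eq (w : FreeGroup (Fin 5)) :
    ∃ Q, FreeGroup.lift skewGen w = skewDiffeo (suRep (FreeGroup.lift suGen w)) Q := by
  induction w using FreeGroup.induction_on with
  | C1 => exact ⟨0, by simp [skewDiffeo_one_zero]⟩
  | of i => exact ⟨_, by simp only [FreeGroup.lift_apply_of]; rfl⟩
  | inv_of i ih =>
    obtain ⟨Q, hQ⟩ := ih
    exact ⟨_, by rw [map_inv, hQ, skewDiffeo_inv, map_inv, map_inv]⟩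
  | mul x y hx hy =>
    obtain ⟨Q, hQ⟩ := hx
    obtain ⟨P, hP⟩ := hy
    exact ⟨_, by rw [map_mul, hQ, hP, skewDiffeo_mul, map_mul, map_mul]⟩

/-- The action on the base S³ already detects the word: SU(2) acts freely there, so fixing one point
forces a trivial matrix. -/
theorem injective_lift_skewGen : Function.Injective (FreeGroup.lift skewGen) := by
  rw [injective_iff_map_eq_one]
  intro w hw
  obtain ⟨Q, hQ⟩ := exists_lift_skewGen_eq w
  rw [hw] at hQ
  have h1 : suRep (FreeGroup.lift suGen w) basePoint = basePoint :=
    (congrArg (fun g : Diff modelM (S3 × Circle) =>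
      ((g (basePoint, 1)).1 : EuclideanSpace ℝ (Fin (3 + 1)))) hQ).symm
  refine (injective_iff_map_eq_one _).1 injective_lift_suGen w
    (eq_one_of_suRep_apply_eq (fun h0 => ?_) h1)
  have h2 := norm_eq_of_mem_sphere basePoint
  rw [h0, norm_zero] at h2
  exact zero_ne_one h2

/-- Every element of the group is an isometry of some metric. -/
theorem exists_preservesMetric_of_mem_closure {g : Diff modelM (S3 × Circle)}
    (hg : g ∈ Subgroup.closure (range skewGen)) :
    ∃ m : SmoothMetric modelM (S3 × Circle), PreservesMetric m g := by
  rw [← FreeGroup.range_lift_eq_closure] at hg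
  obtain ⟨w, rfl⟩ := hg
  rcases eq_or_ne w 1 with rfl | hw
  · rw [map_one]
    exact ⟨ambientMetric 1, one_mem (isometrySubgroup _)⟩
  · obtain ⟨Q, hQ⟩ := exists_lift_skewGen_eq w
    have ha : FreeGroup.lift suGen w ≠ 1 := fun h =>
      hw ((injective_iff_map_eq_one _).1 injective_lift_suGen w h)
    obtain ⟨C, hC⟩ := exists_comp_suRep_sub ha Q
    rw [hQ]
    exact exists_preservesMetric_skewDiffeo hC

/-- A positive word that stretches the fibre over the base point at a linear rate. -/
theorem exists_expanding_word (n : ℕ) : ∃ (L : List (Fin 5)) (R : _) (Q : _), L.length = n ∧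
    (L.map skewGen).prod = skewDiffeo R Q ∧ 1 / 26 ≤ R basePoint 0 ∧
      1 / 26 * (n : ℝ) ≤ Q basePoint 0 := by
  induction n with
  | zero =>
    refine ⟨[], 1, 0, rfl, skewDiffeo_one_zero.symm, ?_, by simp⟩
    simp [basePoint]
    norm_num
  | succ n ih =>
    obtain ⟨L, R, Q, hL, hprod, hR, hQ⟩ := ih
    -- A new letter adds to the cocycle the first coordinate of the current point, not of the next
    -- one. The letter is therefore chosen to keep the next point in {x ≥ 1/26}.
    obtain ⟨i, hi⟩ := exists_suRep_suGen_apply_zero_ge (v := R basePoint) (by simp)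
    refine ⟨i :: L, suRep (suGen i) * R,
      Q + ContinuousLinearMap.id ℝ _ ∘L R.toContinuousLinearEquiv.toContinuousLinearMap,
      by simp [hL], ?_, hi, ?_⟩
    · rw [List.map_cons, List.prod_cons, hprod, skewGen, skewDiffeo_mul]
    · change 1 / 26 * ((n + 1 : ℕ) : ℝ) ≤ Q basePoint 0 + R basePoint 0
      push_cast
      linarith

end SkewGroup

/-! ### Lower bounds for derivatives -/

section LowerBound

/-- The derivative of `ambient` along a curve in `S³ × S¹`. -/
theorem flatDeriv_ambient_mfderiv_curve {γ : ℝ → S3 × Circle}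
    (hγ : MDifferentiableAt 𝓘(ℝ, ℝ) modelM γ 0) {w : WithLp 2 (EuclideanSpace ℝ (Fin (3 + 1)) × ℂ)}
    (hw : HasDerivAt (ambient ∘ γ) w 0) :
    flatDeriv modelM ambient (γ 0) (mfderiv 𝓘(ℝ, ℝ) modelM γ 0 (1 : ℝ)) = w := by
  have h1 := mfderiv_comp (I := 𝓘(ℝ, ℝ)) (I' := modelM)
    (I'' := 𝓘(ℝ, WithLp 2 (EuclideanSpace ℝ (Fin (3 + 1)) × ℂ))) 0
    (g := ambient) (f := γ) (contMDiff_ambient.mdifferentiable (by simp) _) hγ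
  rw [mfderiv_eq_fderiv] at h1
  have h2 := hw.hasFDerivAt.fderiv
  have h3 := congrArg
    (fun L : ℝ →L[ℝ] WithLp 2 (EuclideanSpace ℝ (Fin (3 + 1)) × ℂ) => L 1) (h1.symm.trans h2)
  simp only [ContinuousLinearMap.toSpanSingleton_apply, one_smul] at h3
  exact h3

/-- The fibre over `v`, near the repelling point of the first flow. -/
def fibreCurve (v : S3) (θ : ℝ) : S3 × Circle := (v, circleCurve (quarterPoint 0) θ)

theorem mdifferentiableAt_fibreCurve (v : S3) (θ : ℝ) :
    MDifferentiableAt 𝓘(ℝ, ℝ) modelM (fibreCurve v) θ :=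
  mdifferentiableAt_const.prodMk (mdifferentiableAt_circleCurve _ θ)

theorem hasDerivAt_ambient_fibre (v : S3) {φ : ℝ → ℝ} {c : ℝ} (hφ : HasDerivAt φ c 0) :
    ∃ w, HasDerivAt (fun θ => ambient (v, circleCurve (quarterPoint 0) (φ θ))) w 0 ∧
      ‖w‖ ^ 2 = c ^ 2 := by
  have h1 := (hasDerivAt_coe_circleCurve (quarterPoint 0) (φ 0)).scomp 0 hφ
  have h2 := (hasDerivAt_const (0 : ℝ) (v : EuclideanSpace ℝ (Fin (3 + 1)))).prodMk h1
  have h3 := (WithLp.prodContinuousLinearEquiv 2 ℝ (EuclideanSpace ℝ (Fin (3 + 1))) ℂ).symm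
    |>.toContinuousLinearMap.hasFDerivAt.comp_hasDerivAt (0 : ℝ) h2
  refine ⟨_, h3, ?_⟩
  rw [WithLp.prod_norm_sq_eq_of_L2]
  simp
  rw [Circle.norm_coe, mul_one, sq_abs]

/-- In the product metric, the unit fibre vector over v at the repelling point of the first flow is
stretched by exactly 2^((Q v)₀). The constant C pays only for comparing the two metrics, so it
depends on neither R, Q nor v. -/
theorem exists_exp_le_of_derivNorm_le (m : SmoothMetric modelM (S3 × Circle)) :
    ∃ C : ℝ, ∀ (R : EuclideanSpace ℝ (Fin (3 + 1)) ≃ₗᵢ[ℝ] EuclideanSpace ℝ (Fin (3 + 1)))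
      (Q : EuclideanSpace ℝ (Fin (3 + 1)) →L[ℝ] EuclideanSpace ℝ (Fin (3 + 1))) (v : S3) (K : ℝ),
      0 ≤ K → derivNorm m (skewDiffeo R Q) ≤ ENNReal.ofReal K →
        Real.exp (Q v 0 * Real.log 2) ≤ C * K := by
  obtain ⟨C, hC, h⟩ := (ambientMetric 1).exists_inner_le m
  obtain ⟨C', hC', h'⟩ := m.exists_inner_le (ambientMetric 1)
  refine ⟨Real.sqrt (C * C'), fun R Q v K hK hbound => ?_⟩
  have hinner : ∀ (x : S3 × Circle) (ξ : TangentSpace modelM x),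
      (ambientMetric 1).inner x ξ ξ = ‖flatDeriv modelM ambient x ξ‖ ^ 2 := fun x ξ =>
    real_inner_self_eq_norm_sq (flatDeriv modelM ambient x ξ)
  have hm := mdifferentiableAt_fibreCurve v 0
  obtain ⟨w, hw, hw'⟩ := hasDerivAt_ambient_fibre v (hasDerivAt_id (0 : ℝ))
  obtain ⟨w₁, hw₁, hw₁'⟩ := hasDerivAt_ambient_fibre (sphereIsometry R v)
    (hasDerivAt_angleFlow_zero (Q v 0))
  have hcurve : ambient ∘ skewMap R Q ∘ fibreCurve v =ᶠ[nhds 0] fun θ =>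
      ambient (sphereIsometry R v, circleCurve (quarterPoint 0) (angleFlow (Q v 0) θ)) := by
    filter_upwards [Metric.ball_mem_nhds (0 : ℝ) one_half_pos] with θ hθ
    have h1 := flowProduct_circleCurve (Q v) (θ := θ) (by simpa using hθ)
    exact congrArg (fun s => ambient (sphereIsometry R v, s)) h1
  have hW : MDifferentiableAt modelM modelM (skewDiffeo R Q) (fibreCurve v 0) :=
    (skewDiffeo R Q).mdifferentiable (by simp) _
  have e1 := flatDeriv_ambient_mfderiv_curve hm hw
  have e2 := flatDeriv_ambient_mfderiv_curve (γ := skewDiffeo R Q ∘ fibreCurve v) (hW.comp 0 hm)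
    (hw₁.congr_of_eventuallyEq hcurve)
  have e3 : mfderiv 𝓘(ℝ, ℝ) modelM (skewDiffeo R Q ∘ fibreCurve v) 0 (1 : ℝ) =
      mfderiv modelM modelM (skewDiffeo R Q) (fibreCurve v 0)
        (mfderiv 𝓘(ℝ, ℝ) modelM (fibreCurve v) 0 (1 : ℝ)) :=
    congrArg (fun L : ℝ →L[ℝ] _ => L 1) (mfderiv_comp 0 hW hm)
  rw [e3] at e2
  have hb := ((derivNorm_le_iff hK).1 hbound).1 (fibreCurve v 0)
    (mfderiv 𝓘(ℝ, ℝ) modelM (fibreCurve v) 0 (1 : ℝ))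
  have h1 := h (skewDiffeo R Q (fibreCurve v 0)) (mfderiv modelM modelM (skewDiffeo R Q)
    (fibreCurve v 0) (mfderiv 𝓘(ℝ, ℝ) modelM (fibreCurve v) 0 (1 : ℝ)))
  have h2 := h' (fibreCurve v 0) (mfderiv 𝓘(ℝ, ℝ) modelM (fibreCurve v) 0 (1 : ℝ))
  rw [hinner] at h1 h2
  have h3 : Real.exp (Q v 0 * Real.log 2) ^ 2 ≤ C * C' * K ^ 2 := by
    calc _ = ‖w₁‖ ^ 2 := hw₁'.symm
      _ ≤ C * (K ^ 2 * (C' * 1 ^ 2)) := by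
        rw [← hw', ← e1, ← e2]
        refine h1.trans (mul_le_mul_of_nonneg_left (hb.trans ?_) hC.le)
        exact mul_le_mul_of_nonneg_left h2 (sq_nonneg K)
      _ = _ := by ring
  refine (sq_le_sq₀ (Real.exp_pos _).le (by positivity)).1 ?_
  rwa [mul_pow, Real.sq_sqrt (by positivity)]

/-- If the norm K of the identity were below 1, its powers, again the identity, would have norm at
most Kᵏ → 0, against the lower bound for R = 1, Q = 0. -/
theorem one_le_derivNorm_one (m : SmoothMetric modelM (S3 × Circle)) :
    ENNReal.ofReal 1 ≤ derivNorm m 1 := by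
  by_contra! hlt
  obtain ⟨C, hC⟩ := exists_exp_le_of_derivNorm_le m
  have hK : derivNorm m 1 ≤ ENNReal.ofReal (derivNorm m 1).toReal :=
    (ENNReal.ofReal_toReal (hlt.trans ENNReal.ofReal_lt_top).ne).ge
  set K := (derivNorm m 1).toReal with hKdef
  have hK0 : 0 ≤ K := ENNReal.toReal_nonneg
  have hK1 : K < 1 := by
    rw [hKdef]
    exact (ENNReal.lt_ofReal_iff_toReal_lt (hlt.trans ENNReal.ofReal_lt_top).ne).1 hlt
  have hpow : ∀ k : ℕ, 1 ≤ |C| * K ^ k := by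
    intro k
    have h1 := derivNorm_list_prod_le hK0 (List.replicate k (1 : Diff modelM (S3 × Circle)))
      fun g hg => by rw [List.eq_of_mem_replicate hg]; exact hK
    rw [List.prod_replicate, one_pow, List.length_replicate, ← skewDiffeo_one_zero] at h1
    have h2 := hC 1 0 basePoint _ (pow_nonneg hK0 k) h1
    simp at h2
    exact h2.trans (mul_le_mul_of_nonneg_right (le_abs_self C) (pow_nonneg hK0 k))
  obtain ⟨k, hk⟩ := exists_pow_lt_of_lt_one (show (0 : ℝ) < 1 / (|C| + 1) by positivity) hK1
  have h1 := hpow k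
  rw [lt_div_iff₀ (by positivity)] at hk
  have h2 := pow_nonneg hK0 k
  linarith

/-- For each `n` some positive word of length `n` has a large derivative. -/
theorem exists_word_exp_le_derivNorm (m : SmoothMetric modelM (S3 × Circle)) (n : ℕ) :
    ∃ L : List (Fin 5), L.length = n ∧
      ENNReal.ofReal (Real.exp (Real.log 2 / 52 * n)) ≤ derivNorm m (L.map skewGen).prod := by
  rcases Nat.eq_zero_or_pos n with rfl | hn
  · exact ⟨[], rfl, by simpa using one_le_derivNorm_one m⟩
  -- If every positive word of length n were below K = e^(εn) with ε = log 2 / 52, those of length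
  -- nk would be at most Kᵏ. The expanding word of length nk has size at least K^(2k)/C, as 1/26 =
  -- 2/52; letting k grow gives a contradiction, and no constant is left in the bound for n.
  by_contra! hlt
  obtain ⟨C, hC⟩ := exists_exp_le_of_derivNorm_le m
  set K := Real.exp (Real.log 2 / 52 * n) with hK
  have hK0 : 0 < K := Real.exp_pos _
  have hlog : 0 < Real.log 2 := Real.log_pos one_lt_two
  have hpow : ∀ k : ℕ, K ^ k ≤ C := by
    intro k
    obtain ⟨L, R, Q, hL, hprod, -, hQ⟩ := exists_expanding_word (n * k)
    have h1 := derivNorm_map_prod_le_pow hK0.le (fun L hL => (hlt L hL).le) k L hL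
    rw [hprod] at h1
    have h2 := hC R Q basePoint _ (pow_nonneg hK0.le k) h1
    have h3 : K ^ k * K ^ k ≤ Real.exp (Q basePoint 0 * Real.log 2) := by
      rw [hK, ← Real.exp_nat_mul, ← Real.exp_add, Real.exp_le_exp]
      push_cast at hQ
      have h4 := mul_le_mul_of_nonneg_right hQ hlog.le
      linarith
    exact le_of_mul_le_mul_right (h3.trans h2) (pow_pos hK0 k)
  have hK1 : 1 < K := Real.one_lt_exp_iff.2 (by positivity)
  obtain ⟨k, hk⟩ := pow_unbounded_of_one_lt C hK1
  exact (hpow k).not_gt hk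

end LowerBound

end

theorem theorem1p5 :
    ∃ (Γ : Subgroup (Diff modelM (S3 × Circle))) (k : ℕ)
      (a : Fin k → Matrix.specialUnitaryGroup (Fin 2) ℂ)
      (f : Fin 4 → ℝ → Diff (𝓡 1) Circle)
      (A : Fin k → Diff modelM (S3 × Circle)),
      -- the description of the group
      Function.Injective (FreeGroup.lift a) ∧
      IsFlowQuadruple f ∧
      (∀ i, IsSkewProduct f (a i) (A i)) ∧
      Γ = Subgroup.closure (range A) ∧
      -- exponential growth of derivatives
      (∀ m : SmoothMetric modelM (S3 × Circle), HasExponentialGrowth m Γ) ∧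
      (∀ m : SmoothMetric modelM (S3 × Circle), ∃ ε : ℝ, 0 < ε ∧
        ∃ W : ℕ → Diff modelM (S3 × Circle), ∀ n : ℕ,
          W n ∈ Γ ∧ wordLength (range A) (W n) = n ∧
            ENNReal.ofReal (Real.exp (ε * n)) ≤ derivNorm m (W n)) ∧
      -- every element has bounded derivatives under iteration and preserves a metric
      (∀ g ∈ Γ, ∀ m : SmoothMetric modelM (S3 × Circle), ∃ C : ℝ, ∀ n : ℤ,
        derivNorm m (g ^ n) ≤ ENNReal.ofReal C) ∧
      (∀ g ∈ Γ, ∃ m : SmoothMetric modelM (S3 × Circle), PreservesMetric m g) ∧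
      -- the metric must depend on the element
      ¬ ∃ m : SmoothMetric modelM (S3 × Circle), ∀ g ∈ Γ, PreservesMetric m g := by
  have hε : 0 < Real.log 2 / 52 := div_pos (Real.log_pos one_lt_two) (by norm_num)
  have hW : ∀ m : SmoothMetric modelM (S3 × Circle), ∃ W : ℕ → Diff modelM (S3 × Circle),
      ∀ n : ℕ, W n ∈ Subgroup.closure (range skewGen) ∧ wordLength (range skewGen) (W n) = n ∧
        ENNReal.ofReal (Real.exp (Real.log 2 / 52 * n)) ≤ derivNorm m (W n) := by
    intro m
    choose L hL hexp using exists_word_exp_le_derivNorm m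
    refine ⟨fun n => ((L n).map skewGen).prod, fun n => ⟨?_, ?_, hexp n⟩⟩
    · refine list_prod_mem fun x hx => ?_
      obtain ⟨i, -, rfl⟩ := List.mem_map.1 hx
      exact Subgroup.subset_closure ⟨i, rfl⟩
    · exact (wordLength_map_prod injective_lift_skewGen (L n)).trans (hL n)
  refine ⟨Subgroup.closure (range skewGen), 5, suGen, quarterFlow, skewGen, injective_lift_suGen,
    isFlowQuadruple_quarterFlow, isSkewProduct_skewGen, rfl, fun m => ?_,
    fun m => ⟨_, hε, hW m⟩, fun g hg m => ?_, fun g => exists_preservesMetric_of_mem_closure, ?_⟩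
  · obtain ⟨W, hW⟩ := hW m
    exact hasExponentialGrowth_of_sequence (finite_range _) hε hW
  · obtain ⟨m', hm'⟩ := exists_preservesMetric_of_mem_closure hg
    obtain ⟨C, hC⟩ := exists_derivNorm_le_of_preservesMetric m m'
    exact ⟨C, fun n => hC _ (zpow_mem (show g ∈ isometrySubgroup m' from hm') n)⟩
  · rintro ⟨m, hm⟩
    obtain ⟨W, hW⟩ := hW m
    -- A common invariant metric would give every element norm at most 1, but a word of length one
    -- already has norm at least e^ε > 1 in that metric.
    obtain ⟨hmem, -, hexp⟩ := hW 1
    have h1 := hexp.trans (hm _ hmem).derivNorm_le_one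
    rw [ENNReal.ofReal_le_ofReal_iff zero_le_one, Nat.cast_one, mul_one] at h1
    exact h1.not_gt (Real.one_lt_exp_iff.2 hε)
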